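/- There is an absolute constant $C$ such that the following holds for all integers $m\ge 2$ and $n\ge 0$. Let $\mathcal D=\mathcal D_1\times\dots\times\mathcal D_n$, where $\mathcal D_i$ is any probability distribution of the valuation $v_i$ of buyer $i$ over $m$ items, supported on subadditive valuations. Then $$\textsc{EARev}(\mathcal D,\textsc{BuyMany})\;\le\; C\,(\log m)^2\cdot \textsc{Rev}(\mathcal D,\textsc{SeqItemPricing}).$$ (Both sides are elements of $[0,\infty]$.) Here: * A valuation is a monotone function $v:2^{[m]}\to\mathbb R_{\ge 0}$ with $v(\emptyset)=0$; it is subadditive if $v(S\cup T)\le v(S)+v(T)$ for all $S,T\subseteq[m]$. * A lottery is a probability distribution $\lambda$ on $2^{[m]}$, with value $v(\lambda)=\mathbb E_{S\sim\lambda}[v(S)]$. A price menu $p$ assigns a price $p(\lambda)\in[0,\infty]$ to every lottery ($\infty$ means not offered), and the lottery that gives $\emptyset$ with certainty has price $0$. A buyer with valuation $v$ buys an offered lottery that maximizes $v(\lambda)-p(\lambda)$ and that has maximal price among the maximizers. * A (finite) adaptive buying strategy buys lotteries one after another, where whether and what to buy next may depend on the sets drawn so far; it obtains the union of the drawn sets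 and pays the sum of the prices. A menu $p$ is buy-many if for every adaptive buying strategy there is a lottery $\lambda$ whose price is at most the expected total payment of the strategy, and for which there is a coupling of $S\sim\lambda$ with the random set $S'$ obtained by the strategy such that $S'\subseteq S$. * A buy-many mechanism for $\mathcal D_i$ is a buy-many menu together with a measurable choice of a purchase for $\mathcal D_i$-almost every valuation. Its revenue is the expected price paid, and its allocation is the vector in $[0,1]^m$ of the probabilities with which the items are sold. For $x_i\in\mathbb R_{\ge0}^m$, $\textsc{Rev}_{x_i}(\mathcal D_i,\textsc{BuyMany})$ is the supremum, over all probability distributions over buy-many mechanisms whose expected allocation is at most $x_i$ in every coordinate, of the expected revenue, and $$\textsc{EARev}(\mathcal D,\textsc{BuyMany})=\sup\Big\{\sum_{i=1}^n\textsc{Rev}_{x_i}(\mathcal D_i,\textsc{BuyMany})\;:\;x_i\in\mathbb R_{\ge 0}^m,\ \sum_{i=1}^n x_{ij}\le 1\text{ for all }j\in[m]\Big\}.$$ * A sequential item pricing mechanism interacts with the buyers in the given order $1,\dots,n$. When buyer $i$ arrives and $S_i$ is the set of items left over, it posts item prices in $[0,\infty]$ ($\infty$ means not offered), which may depend on internal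 randomness, on $S_i$ and on $v_1,\dots,v_{i-1}$. The buyer buys a set $B\subseteq S_i$ of finite total price that maximizes $v_i(B)$ minus the total price and that has maximal total price among the maximizers; remaining ties are settled by an arbitrary fixed measurable rule for each buyer, and the inequality holds for every such rule. $\textsc{Rev}(\mathcal D,\textsc{SeqItemPricing})$ is the supremum of the expected total payment, for $v\sim\mathcal D$, over all sequential item pricing mechanisms. -/

import Mathlib

open MeasureTheory
open scoped ENNReal NNReal

noncomputable section

namespace BuyMany

/-! ### Valuations -/

/-- A (normalized, monotone) valuation over `m` items: it assigns a nonnegative value to every set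
of items, the empty set has value `0`, and larger sets are worth at least as much.
The `σ`-algebra is the one inherited from `Finset (Fin m) → ℝ≥0`. -/
abbrev Valuation (m : ℕ) : Type :=
  {v : Finset (Fin m) → ℝ≥0 // v ∅ = 0 ∧ Monotone v}

/-- A valuation is subadditive if `v (S ∪ T) ≤ v S + v T` for all sets of items `S`, `T`. -/
def IsSubadditive {m : ℕ} (v : Valuation m) : Prop :=
  ∀ S T : Finset (Fin m), v.1 (S ∪ T) ≤ v.1 S + v.1 T

/-! ### Lotteries and price menus -/

/-- A lottery is a probability distribution over sets of items. -/
abbrev Lottery (m : ℕ) : Type := PMF (Finset (Fin m))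

/-- The expected value of a lottery. -/
def lotteryValue {m : ℕ} (v : Valuation m) (ℓ : Lottery m) : ℝ :=
  ∑ S : Finset (Fin m), (ℓ S).toReal * (v.1 S : ℝ)

/-- The probability that the random set drawn from the lottery `ℓ` contains item `j`. -/
def itemProb {m : ℕ} (ℓ : Lottery m) (j : Fin m) : ℝ≥0∞ :=
  ∑ S : Finset (Fin m) with j ∈ S, ℓ S

/-- `Dominates ℓ ℓ'`: there is a coupling of `S ∼ ℓ` and `S' ∼ ℓ'` in which `S' ⊆ S`. -/
def Dominates {m : ℕ} (ℓ ℓ' : Lottery m) : Prop :=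
  ∃ κ : PMF (Finset (Fin m) × Finset (Fin m)),
    κ.map Prod.fst = ℓ ∧ κ.map Prod.snd = ℓ' ∧ ∀ x ∈ κ.support, x.2 ⊆ x.1

/-- A price menu gives every lottery a price; price `∞` means that the lottery is not offered.
Getting nothing costs nothing. -/
structure PriceMenu (m : ℕ) where
  price : Lottery m → ℝ≥0∞
  price_empty : price (PMF.pure ∅) = 0

/-- The utility of a buyer with valuation `v` who buys the (offered) lottery `ℓ`. -/
def PriceMenu.utility {m : ℕ} (p : PriceMenu m) (v : Valuation m) (ℓ : Lottery m) : ℝ :=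
  lotteryValue v ℓ - (p.price ℓ).toReal

/-- `ℓ` is a possible purchase of a buyer with valuation `v` facing the menu `p`: it is offered, it
maximizes the utility of the buyer, and it has maximal price among the utility maximizers. -/
def PriceMenu.IsPurchase {m : ℕ} (p : PriceMenu m) (v : Valuation m) (ℓ : Lottery m) : Prop :=
  p.price ℓ ≠ ∞ ∧
  (∀ ℓ', p.price ℓ' ≠ ∞ → p.utility v ℓ' ≤ p.utility v ℓ) ∧
  (∀ ℓ', p.price ℓ' ≠ ∞ → p.utility v ℓ' = p.utility v ℓ → p.price ℓ' ≤ p.price ℓ)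

/-! ### Buy-many menus -/

/-- An adaptive buying strategy: either finish, or buy a lottery, observe the set that was drawn from
it, and continue with a strategy that may depend on that set. -/
inductive Strategy (m : ℕ) : Type
  | done : Strategy m
  | buy (ℓ : Lottery m) (next : Finset (Fin m) → Strategy m) : Strategy m

/-- The distribution of the union of all sets obtained by a strategy. -/
def Strategy.outcome {m : ℕ} : Strategy m → Lottery m
  | .done => PMF.pure ∅
  | .buy ℓ next => ℓ.bind fun S => ((next S).outcome).map fun T => S ∪ T

/-- The expected total price paid by a strategy under the price menu `p`. -/
def Strategy.cost {m : ℕ} (p : PriceMenu m) : Strategy m → ℝ≥0∞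
  | .done => 0
  | .buy ℓ next => p.price ℓ + ∑ S : Finset (Fin m), ℓ S * (next S).cost p

/-- The class of buy-many menus: for every adaptive strategy there is a single lottery which
dominates the random set obtained by the strategy and costs at most as much. -/
def buyManyMenus (m : ℕ) : Set (PriceMenu m) :=
  {p | ∀ A : Strategy m, ∃ ℓ : Lottery m, Dominates ℓ A.outcome ∧ p.price ℓ ≤ A.cost p}

/-! ### Single-buyer mechanisms and the ex ante relaxation -/

/-- A single-buyer mechanism of class `𝒞` for the value distribution `D`: a price menu in `𝒞`
together with a purchase for (almost) every type of the buyer. -/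
structure Mechanism {m : ℕ} (D : Measure (Valuation m)) (𝒞 : Set (PriceMenu m)) where
  menu : PriceMenu m
  menu_mem : menu ∈ 𝒞
  /-- the lottery bought by each type -/
  choice : Valuation m → Lottery m
  isPurchase_choice : ∀ᵐ v ∂D, menu.IsPurchase v (choice v)
  aemeasurable_choice : ∀ S : Finset (Fin m), AEMeasurable (fun v => choice v S) D
  aemeasurable_price : AEMeasurable (fun v => menu.price (choice v)) D

variable {m : ℕ} {D : Measure (Valuation m)} {𝒞 : Set (PriceMenu m)}

/-- The expected revenue of a mechanism. -/
def Mechanism.revenue (M : Mechanism D 𝒞) : ℝ≥0∞ :=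
  ∫⁻ v, M.menu.price (M.choice v) ∂D

/-- The expected allocation of a mechanism: the probability that item `j` is sold. -/
def Mechanism.alloc (M : Mechanism D 𝒞) (j : Fin m) : ℝ≥0∞ :=
  ∫⁻ v, itemProb (M.choice v) j ∂D

/-- The coarsest `σ`-algebra on mechanisms which makes revenue and allocation measurable. -/
instance : MeasurableSpace (Mechanism D 𝒞) :=
  MeasurableSpace.comap (fun M => (M.revenue, M.alloc)) inferInstance

/-- The optimal expected revenue from a buyer with value distribution `D`, over all probability
distributions over mechanisms of class `𝒞` whose expected allocation is at most `x`. -/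
def revEx {m : ℕ} (D : Measure (Valuation m)) (𝒞 : Set (PriceMenu m)) (x : Fin m → ℝ≥0) : ℝ≥0∞ :=
  ⨆ (μ : ProbabilityMeasure (Mechanism D 𝒞))
    (_ : ∀ j, ∫⁻ M, M.alloc j ∂(μ : Measure (Mechanism D 𝒞)) ≤ x j),
    ∫⁻ M, M.revenue ∂(μ : Measure (Mechanism D 𝒞))

/-- The optimal ex ante revenue under the class `𝒞` from `n` buyers with value distributions `D i`:
every item is sold at most once in expectation. -/
def eaRev {n m : ℕ} (D : Fin n → Measure (Valuation m)) (𝒞 : Set (PriceMenu m)) : ℝ≥0∞ :=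
  ⨆ (x : Fin n → Fin m → ℝ≥0) (_ : ∀ j, ∑ i, x i j ≤ 1), ∑ i, revEx (D i) 𝒞 (x i)

/-! ### Sequential item pricing -/

/-- The utility of a buyer who buys the bundle `B` under the item prices `p`. -/
def bundleUtility {m : ℕ} (v : Valuation m) (p : Fin m → ℝ≥0∞) (B : Finset (Fin m)) : ℝ :=
  (v.1 B : ℝ) - (∑ j ∈ B, p j).toReal

/-- `B` is a possible purchase of a buyer with valuation `v` who is offered the items of `A` at item
prices `p`: it is a set of finite price, it maximizes the utility of the buyer, and it has maximal
price among the utility maximizers. An item of price `∞` is never bought. -/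
def IsBundlePurchase {m : ℕ} (v : Valuation m) (A : Finset (Fin m)) (p : Fin m → ℝ≥0∞)
    (B : Finset (Fin m)) : Prop :=
  (B ⊆ A ∧ ∑ j ∈ B, p j ≠ ∞) ∧
  (∀ B' ⊆ A, ∑ j ∈ B', p j ≠ ∞ → bundleUtility v p B' ≤ bundleUtility v p B) ∧
  (∀ B' ⊆ A, ∑ j ∈ B', p j ≠ ∞ → bundleUtility v p B' = bundleUtility v p B →
    ∑ j ∈ B', p j ≤ ∑ j ∈ B, p j)

/-- A rule by which a buyer settles the remaining ties: it picks, measurably, a purchase for every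
valuation, every set of available items and every item pricing. -/
structure PurchaseRule (m : ℕ) where
  buy : Valuation m → Finset (Fin m) → (Fin m → ℝ≥0∞) → Finset (Fin m)
  isBundlePurchase : ∀ v A p, IsBundlePurchase v A p (buy v A p)
  measurable : ∀ A B : Finset (Fin m),
    MeasurableSet {x : Valuation m × (Fin m → ℝ≥0∞) | buy x.1 A x.2 = B}

/-- A (randomized) sequential item pricing for `n` buyers, who arrive in the order `0, 1, …`.
When buyer `i` arrives and `A` is the set of items left over, the mechanism posts an item pricing,
which may depend on its random seed, on `A` and on the valuations of the buyers before `i`. -/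
structure SeqItemPricing (n m : ℕ) where
  Seed : Type
  [seedSpace : MeasurableSpace Seed]
  seedLaw : ProbabilityMeasure Seed
  price : Seed → (Fin n → Valuation m) → Fin n → Finset (Fin m) → Fin m → ℝ≥0∞
  nonanticipating : ∀ ω v w i, (∀ k < i, v k = w k) → price ω v i = price ω w i
  measurable_price : ∀ i A j,
    Measurable fun x : Seed × (Fin n → Valuation m) => price x.1 x.2 i A j

attribute [instance] SeqItemPricing.seedSpace

namespace SeqItemPricing

variable {n m : ℕ} (M : SeqItemPricing n m) (rule : Fin n → PurchaseRule m)
  (ω : M.Seed) (v : Fin n → Valuation m)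

/-- The set of items left over after the first `k` buyers. -/
def remaining : ℕ → Finset (Fin m)
  | 0 => Finset.univ
  | k + 1 =>
    if h : k < n then
      remaining k \ (rule ⟨k, h⟩).buy (v ⟨k, h⟩) (remaining k) (M.price ω v ⟨k, h⟩ (remaining k))
    else remaining k

/-- The item prices posted to buyer `i`. -/
def posted (i : Fin n) : Fin m → ℝ≥0∞ :=
  M.price ω v i (M.remaining rule ω v i)

/-- The bundle bought by buyer `i`. -/
def bundle (i : Fin n) : Finset (Fin m) :=
  (rule i).buy (v i) (M.remaining rule ω v i) (M.posted rule ω v i)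

/-- The payment of buyer `i`. -/
def payment (i : Fin n) : ℝ≥0∞ :=
  ∑ j ∈ M.bundle rule ω v i, M.posted rule ω v i j

/-- The expected revenue from independent buyers with value distributions `D i`. -/
def revenue (D : Fin n → Measure (Valuation m)) : ℝ≥0∞ :=
  ∫⁻ ω, ∫⁻ v, ∑ i, M.payment rule ω v i ∂(Measure.pi D) ∂(M.seedLaw : Measure M.Seed)

end SeqItemPricing

/-- The optimal revenue of sequential item pricing. -/
def seqRev {n m : ℕ} (D : Fin n → Measure (Valuation m)) (rule : Fin n → PurchaseRule m) : ℝ≥0∞ :=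
  ⨆ M : SeqItemPricing n m, M.revenue rule D

end BuyMany

end

/-!
Buyer `i` sees item `j` at one of `N = O(log m)` roughly doubling price levels, chosen uniformly at
random. The price is an opportunity cost of the item plus a term that doubles from level to level;
from each level to the next, the opportunity cost is multiplied by one plus the probability that
the item is sold at that level, and the next buyer starts from the last value. The total cost then
grows only as fast as `N` times the revenue, whereas an item sold with probability one half would
have a cost exponential in `N`. So every item stays available with probability at least one half.

For a subadditive valuation, `O(log m)` independent samples of the available set cover all items,
which costs a factor `O(log m)` against the full supply. As the levels double, utilities telescope
along them into payments, at the price of the second factor `O(log m)`. This bounds the revenue of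
the cheap lotteries of a menu. For the expensive ones, a buyer of a buy-many menu can keep buying
until every wanted item has been drawn, which amounts to prices per unit of allocation, and hence
obtains at least the utility of item prices derived from the menu. With a price floor above twice
the optimal revenue, hardly anything is ever sold, so that every buyer meets the full supply with
probability at least one half.
-/

noncomputable section

namespace BuyMany

section Covering

variable {ι κ : Type*} [DecidableEq ι] [Fintype κ] {g : Finset ι → ℝ≥0∞} {w : κ → ℝ≥0∞}
  {A : κ → Finset ι} {T : Finset ι} {δ : ℝ≥0∞}

lemma sum_mul_card_sdiff_le (U : Finset ι) (hδ : ∀ j ∈ U, ∑ k with j ∉ A k, w k ≤ δ) :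
    ∑ k, w k * ((U \ A k).card : ℝ≥0∞) ≤ U.card * δ := by
  calc ∑ k, w k * ((U \ A k).card : ℝ≥0∞)
      = ∑ k, ∑ j ∈ U, if j ∉ A k then w k else 0 :=
        Finset.sum_congr rfl fun k _ => by
          rw [← Finset.filter_notMem_eq_sdiff, ← Finset.sum_filter, Finset.sum_const,
            nsmul_eq_mul, mul_comm]
    _ = ∑ j ∈ U, ∑ k with j ∉ A k, w k := by
        rw [Finset.sum_comm]
        simp only [Finset.sum_filter]
    _ ≤ U.card * δ := by
        simpa only [nsmul_eq_mul] using Finset.sum_le_card_nsmul U _ δ hδ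

/- Each of `s` independent samples of `A` contributes at most the expected value of `T ∩ A`, and
what they leave uncovered has at most `U.card * δ ^ s` elements in expectation. -/
lemma le_mul_sum_inter_add (h_empty : g ∅ = 0) (h_mono : Monotone g)
    (h_union : ∀ S S', g (S ∪ S') ≤ g S + g S') (hw : ∑ k, w k = 1)
    (hδ : ∀ j ∈ T, ∑ k with j ∉ A k, w k ≤ δ) (s : ℕ) {U : Finset ι} (hU : U ⊆ T) :
    g U ≤ s * ∑ k, w k * g (T ∩ A k) + U.card * δ ^ s * g T := by
  set E := ∑ k, w k * g (T ∩ A k) with hE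
  induction s generalizing U with
  | zero =>
    rcases U.eq_empty_or_nonempty with rfl | hne
    · simp [h_empty]
    · have hcard : (1 : ℝ≥0∞) ≤ U.card := by exact_mod_cast hne.card_pos
      simpa using (h_mono hU).trans (le_mul_of_one_le_left' hcard)
  | succ s ih =>
    have hsplit : ∀ k, g U ≤ g (T ∩ A k) + g (U \ A k) := fun k =>
      (h_mono fun j hj => by
        by_cases hjA : j ∈ A k
        · exact Finset.mem_union_left _ (Finset.mem_inter.2 ⟨hU hj, hjA⟩)
        · exact Finset.mem_union_right _ (Finset.mem_sdiff.2 ⟨hj, hjA⟩)).trans (h_union _ _)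
    calc g U = ∑ k, w k * g U := by rw [← Finset.sum_mul, hw, one_mul]
      _ ≤ ∑ k, w k * (g (T ∩ A k) + (s * E + (U \ A k).card * δ ^ s * g T)) := by
          gcongr with k
          refine (hsplit k).trans ?_
          gcongr
          exact ih (Finset.sdiff_subset.trans hU)
      _ = E + s * E + (∑ k, w k * ((U \ A k).card : ℝ≥0∞)) * (δ ^ s * g T) := by
          simp only [mul_add, Finset.sum_add_distrib, ← Finset.sum_mul, hw, one_mul, ← hE,
            mul_assoc]
          simp only [← mul_assoc (w _), ← Finset.sum_mul, add_assoc]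
      _ ≤ E + s * E + U.card * δ * (δ ^ s * g T) := by
          gcongr
          exact sum_mul_card_sdiff_le U fun j hj => hδ j (hU hj)
      _ = (s + 1 : ℕ) * E + U.card * δ ^ (s + 1) * g T := by
          push_cast
          ring

lemma le_two_mul_sum_inter (h_empty : g ∅ = 0) (h_mono : Monotone g)
    (h_union : ∀ S S', g (S ∪ S') ≤ g S + g S') (hT : g T ≠ ∞) (hw : ∑ k, w k = 1)
    (hA : ∀ j ∈ T, ∑ k with j ∉ A k, w k ≤ 2⁻¹) {s : ℕ} (hs : 2 * T.card ≤ 2 ^ s) :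
    g T ≤ 2 * s * ∑ k, w k * g (T ∩ A k) := by
  have h := le_mul_sum_inter_add h_empty h_mono h_union hw hA s subset_rfl
  have hcard : 2 * (T.card * (2⁻¹ : ℝ≥0∞) ^ s) ≤ 1 := by
    rw [← mul_assoc, ← ENNReal.inv_pow, ← div_eq_mul_inv]
    exact ENNReal.div_le_of_le_mul (by rw [one_mul]; exact_mod_cast hs)
  refine ENNReal.le_of_add_le_add_right hT ?_
  calc g T + g T = 2 * g T := (two_mul _).symm
    _ ≤ 2 * (s * ∑ k, w k * g (T ∩ A k) + T.card * 2⁻¹ ^ s * g T) := by gcongr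
    _ = 2 * s * ∑ k, w k * g (T ∩ A k) + 2 * (T.card * (2⁻¹ : ℝ≥0∞) ^ s) * g T := by ring
    _ ≤ 2 * s * ∑ k, w k * g (T ∩ A k) + g T := by
        gcongr
        exact mul_le_of_le_one_left' hcard

end Covering

section Bundles

variable {m : ℕ} {v : Valuation m} {A B S : Finset (Fin m)}

lemma IsBundlePurchase.price_le {r : Fin m → ℝ≥0∞} (h : IsBundlePurchase v A r B) :
    ∑ j ∈ B, r j ≤ (v.1 B : ℝ≥0∞) := by
  have h_utility := h.2.1 ∅ (Finset.empty_subset _) (by simp)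
  simp only [bundleUtility, v.2.1, Finset.sum_empty, NNReal.coe_zero, ENNReal.toReal_zero,
    sub_zero, sub_nonneg] at h_utility
  rw [← ENNReal.ofReal_toReal h.1.2, ← ENNReal.ofReal_coe_nnreal]
  exact ENNReal.ofReal_le_ofReal h_utility

lemma IsBundlePurchase.value_le {r : Fin m → ℝ≥0∞} (h : IsBundlePurchase v A r B) (hS : S ⊆ A) :
    (v.1 S : ℝ≥0∞) ≤ ∑ j ∈ S, r j + ((v.1 B : ℝ≥0∞) - ∑ j ∈ B, r j) := by
  by_cases hfin : ∑ j ∈ S, r j = ∞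
  · simp [hfin]
  have h_utility := h.2.1 S hS hfin
  simp only [bundleUtility] at h_utility
  rw [← ENNReal.ofReal_toReal hfin, ← ENNReal.ofReal_toReal h.1.2,
    ← ENNReal.ofReal_coe_nnreal, ← ENNReal.ofReal_coe_nnreal,
    ← ENNReal.ofReal_sub _ ENNReal.toReal_nonneg]
  refine le_trans (ENNReal.ofReal_le_ofReal ?_) ENNReal.ofReal_add_le
  linarith

variable {r : ℕ → Fin m → ℝ≥0∞} {C : ℕ → Finset (Fin m)}

/- Since prices at most double, the utility at level `k` is at most the payment at level `k` plus
the utility at level `k + 1`. -/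
lemma value_le_sum_payments_add_utility (hC : ∀ k, IsBundlePurchase v A (r k) (C k))
    (hr : ∀ k j, r (k + 1) j ≤ 2 * r k j) (K : ℕ) (hS : S ⊆ A) :
    (v.1 S : ℝ≥0∞) ≤ ∑ j ∈ S, r 0 j + ∑ k ∈ Finset.range K, ∑ j ∈ C k, r k j
      + ((v.1 (C K) : ℝ≥0∞) - ∑ j ∈ C K, r K j) := by
  induction K with
  | zero => simpa using (hC 0).value_le hS
  | succ K ih =>
    have h_telescope : (v.1 (C K) : ℝ≥0∞) - ∑ j ∈ C K, r K j
        ≤ ∑ j ∈ C K, r K j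
          + ((v.1 (C (K + 1)) : ℝ≥0∞) - ∑ j ∈ C (K + 1), r (K + 1) j) := by
      refine tsub_le_iff_left.2 (((hC (K + 1)).value_le (hC K).1.1).trans ?_)
      rw [← add_assoc, ← two_mul, Finset.mul_sum]
      gcongr
      exact hr K _
    refine ih.trans ((add_le_add_right h_telescope _).trans_eq ?_)
    rw [Finset.sum_range_succ]
    ring

lemma min_value_le_sum_payments (hC : ∀ k, IsBundlePurchase v A (r k) (C k))
    (hr : ∀ k j, r (k + 1) j ≤ 2 * r k j) (K : ℕ) {ρ : ℝ≥0∞} (hρ : ∀ j, ρ ≤ r K j) (hS : S ⊆ A) :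
    min (v.1 S : ℝ≥0∞) ρ ≤
      ∑ j ∈ S, r 0 j + ∑ k ∈ Finset.range (K + 1), ∑ j ∈ C k, r k j := by
  rw [Finset.sum_range_succ, ← add_assoc]
  rcases (C K).eq_empty_or_nonempty with h_empty | ⟨j, hj⟩
  · refine (min_le_left _ _).trans ((value_le_sum_payments_add_utility hC hr K hS).trans ?_)
    simp [h_empty, v.2.1]
  · calc min (v.1 S : ℝ≥0∞) ρ ≤ r K j := (min_le_right _ _).trans (hρ j)
      _ ≤ ∑ j ∈ C K, r K j := Finset.single_le_sum (f := r K) (fun _ _ => zero_le) hj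
      _ ≤ _ := le_add_self

end Bundles

section FiniteRange

lemma lintegral_comp_of_fintype {Ω α : Type*} [MeasurableSpace Ω] [Fintype α] [MeasurableSpace α]
    [MeasurableSingletonClass α] (μ : Measure Ω) {f : Ω → α} (hf : Measurable f) (g : α → ℝ≥0∞) :
    ∫⁻ ω, g (f ω) ∂μ = ∑ a, μ {ω | f ω = a} * g a := by
  rw [← lintegral_map (measurable_of_finite g) hf, lintegral_fintype]
  refine Finset.sum_congr rfl fun a _ => ?_
  rw [Measure.map_apply hf (measurableSet_singleton a), mul_comm]
  rfl

end FiniteRange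

section Resampling

variable {ι : Type*} [Fintype ι] [DecidableEq ι] {π : ι → Type*} [∀ i, MeasurableSpace (π i)]
  (μ : ∀ i, Measure (π i)) [∀ i, IsProbabilityMeasure (μ i)]

lemma lintegral_pi_resample (i : ι) {F : (∀ i, π i) → π i → ℝ≥0∞}
    (hF : Measurable (Function.uncurry F)) (hi : ∀ x y z, F (Function.update x i y) z = F x z) :
    ∫⁻ x, F x (x i) ∂(Measure.pi μ) = ∫⁻ x, ∫⁻ y, F x y ∂(μ i) ∂(Measure.pi μ) := by
  have h_marginal := lmarginal_eq_of_subset (μ := μ) (f := fun x => F x (x i))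
    (g := fun x => ∫⁻ y, F x y ∂(μ i)) (Finset.subset_univ {i})
    (hF.comp (measurable_id.prodMk (measurable_pi_apply i))) hF.lintegral_prod_right'
    (by ext x; simp [lmarginal_singleton, hi])
  rw [lmarginal_univ, lmarginal_univ] at h_marginal
  exact congrFun h_marginal fun j => (μ j).nonempty_of_neZero.some

lemma lintegral_pi_comp_eval {α : Type*} [Fintype α] [MeasurableSpace α]
    [MeasurableSingletonClass α] (i : ι) {f : (∀ i, π i) → α} (hf : Measurable f)
    (hi : ∀ x y, f (Function.update x i y) = f x) {g : α → π i → ℝ≥0∞}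
    (hg : ∀ a, Measurable (g a)) :
    ∫⁻ x, g (f x) (x i) ∂(Measure.pi μ)
      = ∑ a, Measure.pi μ {x | f x = a} * ∫⁻ y, g a y ∂(μ i) := by
  have hg' : Measurable (Function.uncurry g) := measurable_from_prod_countable_right hg
  rw [lintegral_pi_resample μ i (F := fun x y => g (f x) y)
    (hg'.comp ((hf.comp measurable_fst).prodMk measurable_snd)) (by simp [hi])]
  exact lintegral_comp_of_fintype _ hf fun a => ∫⁻ y, g a y ∂(μ i)

end Resampling

section Levels

variable {N : ℕ} {f g : ℕ → ℝ≥0∞}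

/-- The average of `f` over the levels `0, …, N - 1`. -/
def levelAvg (N : ℕ) (f : ℕ → ℝ≥0∞) : ℝ≥0∞ :=
  (N : ℝ≥0∞)⁻¹ * ∑ k ∈ Finset.range N, f k

lemma levelAvg_mono (h : ∀ k < N, f k ≤ g k) : levelAvg N f ≤ levelAvg N g :=
  mul_le_mul_right (Finset.sum_le_sum fun k hk => h k (Finset.mem_range.1 hk)) _

lemma sum_levelAvg {ι : Type*} (s : Finset ι) (f : ι → ℕ → ℝ≥0∞) :
    ∑ a ∈ s, levelAvg N (f a) = levelAvg N fun k => ∑ a ∈ s, f a k := by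
  simp only [levelAvg, ← Finset.mul_sum, Finset.sum_comm (s := s)]

lemma levelAvg_mul_left (c : ℝ≥0∞) : levelAvg N (fun k => c * f k) = c * levelAvg N f := by
  simp only [levelAvg, ← Finset.mul_sum]
  ring

lemma levelAvg_add (f g : ℕ → ℝ≥0∞) :
    levelAvg N (fun k => f k + g k) = levelAvg N f + levelAvg N g := by
  simp only [levelAvg, Finset.sum_add_distrib, mul_add]

variable [NeZero N]

lemma natCast_mul_levelAvg (f : ℕ → ℝ≥0∞) :
    N * levelAvg N f = ∑ k ∈ Finset.range N, f k := by
  rw [levelAvg, ← mul_assoc,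
    ENNReal.mul_inv_cancel (by exact_mod_cast NeZero.ne N) (ENNReal.natCast_ne_top N), one_mul]

lemma levelAvg_const (c : ℝ≥0∞) : levelAvg N (fun _ => c) = c := by
  rw [levelAvg, Finset.sum_const, Finset.card_range, nsmul_eq_mul, ← mul_assoc,
    ENNReal.inv_mul_cancel (by exact_mod_cast NeZero.ne N) (ENNReal.natCast_ne_top N), one_mul]

/-- The law of a uniformly random level below `N`. -/
def levelLaw (N : ℕ) [NeZero N] : Measure (Fin N) :=
  (PMF.uniformOfFintype (Fin N)).toMeasure

instance : IsProbabilityMeasure (levelLaw N) :=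
  PMF.toMeasure.isProbabilityMeasure _

lemma lintegral_levelLaw (f : ℕ → ℝ≥0∞) : ∫⁻ k, f k ∂(levelLaw N) = levelAvg N f := by
  simp only [lintegral_fintype, levelLaw,
    PMF.toMeasure_apply_singleton _ _ (measurableSet_singleton _), PMF.uniformOfFintype_apply,
    Fintype.card_fin, ← Finset.sum_mul, Fin.sum_univ_eq_sum_range, levelAvg, mul_comm]

lemma lintegral_levelLaw_prod {α : Type*} [MeasurableSpace α] (μ : Measure α) [SFinite μ]
    {g : ℕ → α → ℝ≥0∞} (hg : ∀ k, Measurable (g k)) :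
    ∫⁻ y : Fin N × α, g y.1 y.2 ∂((levelLaw N).prod μ)
      = levelAvg N fun k => ∫⁻ a, g k a ∂μ := by
  rw [lintegral_prod _
    (measurable_from_prod_countable_right fun k : Fin N => hg k).aemeasurable]
  exact lintegral_levelLaw fun k => ∫⁻ a, g k a ∂μ

end Levels

section BuyersAtLevels

variable {m : ℕ}

lemma PurchaseRule.buy_subset (b : PurchaseRule m) (v : Valuation m) (A : Finset (Fin m))
    (r : Fin m → ℝ≥0∞) : b.buy v A r ⊆ A := (b.isBundlePurchase v A r).1.1

lemma PurchaseRule.measurable_buy (b : PurchaseRule m) (A : Finset (Fin m)) :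
    Measurable fun x : Valuation m × (Fin m → ℝ≥0∞) => b.buy x.1 A x.2 :=
  measurable_to_countable' fun B => b.measurable A B

lemma PurchaseRule.measurable_buy_left (b : PurchaseRule m) (A : Finset (Fin m))
    (r : Fin m → ℝ≥0∞) : Measurable fun v => b.buy v A r :=
  (b.measurable_buy A).comp (measurable_id.prodMk measurable_const)

lemma PurchaseRule.measurable_buy_level (b : PurchaseRule m) (N : ℕ) (A : Finset (Fin m))
    (r : ℕ → Fin m → ℝ≥0∞) :
    Measurable fun y : Fin N × Valuation m => b.buy y.2 A (r y.1) :=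
  (b.measurable_buy A).comp
    (measurable_snd.prodMk ((measurable_of_finite fun k : Fin N => r k).comp measurable_fst))

/-- The payment of a buyer who faces item prices `r` for the items of `A`. -/
def pay (b : PurchaseRule m) (v : Valuation m) (A : Finset (Fin m)) (r : Fin m → ℝ≥0∞) : ℝ≥0∞ :=
  ∑ j ∈ b.buy v A r, r j

lemma measurable_pay (b : PurchaseRule m) (A : Finset (Fin m)) (r : Fin m → ℝ≥0∞) :
    Measurable fun v => pay b v A r :=
  (measurable_of_finite fun B : Finset (Fin m) => ∑ j ∈ B, r j).comp (b.measurable_buy_left A r)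

/-- The expected revenue from the items of `A` if the item prices are `r k` at a uniformly random
level `k < N`. -/
def setRev (b : PurchaseRule m) (D : Measure (Valuation m)) (N : ℕ) (r : ℕ → Fin m → ℝ≥0∞)
    (A : Finset (Fin m)) : ℝ≥0∞ :=
  levelAvg N fun k => ∫⁻ v, pay b v A (r k) ∂D

/-- The expected revenue if the item prices are `r k` at a uniformly random level `k < N` and the
set of available items has law `a`. -/
def lawRev (b : PurchaseRule m) (D : Measure (Valuation m)) (N : ℕ) (r : ℕ → Fin m → ℝ≥0∞)
    (a : Finset (Fin m) → ℝ≥0∞) : ℝ≥0∞ :=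
  ∑ A, a A * setRev b D N r A

/-- The law of the items left over by a buyer who faces the item prices `r k` at a uniformly random
level `k < N`, if the set of items available to that buyer has law `a`. -/
def availStep (b : PurchaseRule m) (D : Measure (Valuation m)) (N : ℕ) (r : ℕ → Fin m → ℝ≥0∞)
    (a : Finset (Fin m) → ℝ≥0∞) (A' : Finset (Fin m)) : ℝ≥0∞ :=
  ∑ A, a A * levelAvg N fun k => D {v | A \ b.buy v A (r k) = A'}

end BuyersAtLevels

section LevelPricing

variable {n m : ℕ} (D : Fin n → Measure (Valuation m)) (rule : Fin n → PurchaseRule m) (N : ℕ)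
  (r : Fin n → ℕ → Fin m → ℝ≥0∞)

/-- The law of the items left over by the first `i` buyers, if buyer `i` faces the item prices
`r i k` at a uniformly random level `k < N`. -/
def availLaw : ℕ → Finset (Fin m) → ℝ≥0∞
  | 0 => Pi.single Finset.univ 1
  | i + 1 => if h : i < n then
      availStep (rule ⟨i, h⟩) (D ⟨i, h⟩) N (r ⟨i, h⟩) (availLaw i)
    else availLaw i

/-- The expected revenue from buyer `i`, if each buyer `l` faces the item prices `r l k` at a
uniformly random level `k < N`; zero if there is no such buyer. -/
def buyerRev (i : ℕ) : ℝ≥0∞ :=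
  if h : i < n then lawRev (rule ⟨i, h⟩) (D ⟨i, h⟩) N (r ⟨i, h⟩) (availLaw D rule N r i) else 0

variable [NeZero N]

/-- The sequential item pricing that posts the prices `r i k` to buyer `i`, where the level `k` is
uniformly random and independent for all buyers. -/
def levelPricing : SeqItemPricing n m where
  Seed := Fin n → Fin N
  seedLaw := ⟨Measure.pi fun _ => levelLaw N, inferInstance⟩
  price ω _ i _ j := r i (ω i) j
  nonanticipating _ _ _ _ _ := rfl
  measurable_price i _ j :=
    (measurable_of_finite fun ω : Fin n → Fin N => r i (ω i) j).comp measurable_fst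

/-- The set of items that the first `k` buyers leave over under `levelPricing`, as a function of
the level and the valuation of every buyer. -/
def leftover (x : Fin n → Fin N × Valuation m) (k : ℕ) : Finset (Fin m) :=
  (levelPricing N r).remaining rule (fun i => (x i).1) (fun i => (x i).2) k

lemma leftover_succ (x : Fin n → Fin N × Valuation m) {k : ℕ} (hk : k < n) :
    leftover rule N r x (k + 1) = leftover rule N r x k \
      (rule ⟨k, hk⟩).buy (x ⟨k, hk⟩).2 (leftover rule N r x k) (r ⟨k, hk⟩ (x ⟨k, hk⟩).1) := by
  simp only [leftover, SeqItemPricing.remaining, dif_pos hk]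
  rfl

lemma leftover_succ_of_le (x : Fin n → Fin N × Valuation m) {k : ℕ} (hk : n ≤ k) :
    leftover rule N r x (k + 1) = leftover rule N r x k := by
  simp only [leftover, SeqItemPricing.remaining, dif_neg hk.not_gt]

lemma leftover_congr {x y : Fin n → Fin N × Valuation m} (k : ℕ)
    (h : ∀ i : Fin n, (i : ℕ) < k → x i = y i) :
    leftover rule N r x k = leftover rule N r y k := by
  induction k with
  | zero => rfl
  | succ k ih =>
    have ih := ih fun i hi => h i (by omega)
    rcases lt_or_ge k n with hk | hk
    · rw [leftover_succ rule N r _ hk, leftover_succ rule N r _ hk, ih,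
        h ⟨k, hk⟩ (Nat.lt_succ_self k)]
    · rw [leftover_succ_of_le rule N r _ hk, leftover_succ_of_le rule N r _ hk, ih]

lemma measurable_leftover (k : ℕ) : Measurable fun x => leftover rule N r x k := by
  induction k with
  | zero => exact measurable_const
  | succ k ih =>
    rcases lt_or_ge k n with hk | hk
    · simp only [leftover_succ rule N r _ hk]
      have h_step : Measurable (Function.uncurry fun (A : Finset (Fin m))
          (y : Fin N × Valuation m) => A \ (rule ⟨k, hk⟩).buy y.2 A (r ⟨k, hk⟩ y.1)) :=
        measurable_from_prod_countable_right fun A =>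
          (measurable_of_finite fun B : Finset (Fin m) => A \ B).comp
            ((rule ⟨k, hk⟩).measurable_buy_level N A _)
      exact h_step.comp (ih.prodMk (measurable_pi_apply _))
    · simpa only [leftover_succ_of_le rule N r _ hk] using ih

/-- The joint law of independent levels and valuations of all buyers. -/
abbrev jointLaw : Measure (Fin n → Fin N × Valuation m) :=
  Measure.pi fun i => (levelLaw N).prod (D i)

variable [∀ i, IsProbabilityMeasure (D i)]

lemma lintegral_comp_leftover (i : Fin n) {g : Finset (Fin m) → ℕ → Valuation m → ℝ≥0∞}
    (hg : ∀ A k, Measurable (g A k)) :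
    ∫⁻ x, g (leftover rule N r x i) (x i).1 (x i).2 ∂(jointLaw D N)
      = ∑ A, jointLaw D N {x | leftover rule N r x i = A}
          * levelAvg N fun k => ∫⁻ v, g A k v ∂(D i) := by
  rw [lintegral_pi_comp_eval (fun i => (levelLaw N).prod (D i)) i
    (measurable_leftover rule N r i) (g := fun A y => g A y.1 y.2)
    (fun x y => leftover_congr rule N r i fun l hl =>
      Function.update_of_ne (fun h => by simp [h] at hl) _ _)
    fun A => measurable_from_prod_countable_right fun k : Fin N => hg A k]
  simp only [lintegral_levelLaw_prod (D i) (hg _)]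

lemma jointLaw_leftover_eq (k : ℕ) (A : Finset (Fin m)) :
    jointLaw D N {x | leftover rule N r x k = A} = availLaw D rule N r k A := by
  induction k generalizing A with
  | zero =>
    by_cases hA : A = Finset.univ
    · simp [leftover, SeqItemPricing.remaining, availLaw, hA]
    · simp [leftover, SeqItemPricing.remaining, availLaw, hA, Ne.symm hA]
  | succ k ih =>
    rcases lt_or_ge k n with hk | hk
    · have h_meas : ∀ A' l,
          MeasurableSet {v | A' \ (rule ⟨k, hk⟩).buy v A' (r ⟨k, hk⟩ l) = A} := fun A' l =>
        ((measurable_of_finite fun B : Finset (Fin m) => A' \ B).comp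
          ((rule ⟨k, hk⟩).measurable_buy_left A' (r ⟨k, hk⟩ l))) (measurableSet_singleton A)
      have h_step := lintegral_comp_leftover D rule N r ⟨k, hk⟩
        (g := fun A' l => Set.indicator {v | A' \ (rule ⟨k, hk⟩).buy v A' (r ⟨k, hk⟩ l) = A} 1)
        fun A' l => measurable_one.indicator (h_meas A' l)
      simp only [lintegral_indicator_one (h_meas _ _), ih] at h_step
      rw [availLaw, dif_pos hk, availStep, ← h_step, ← lintegral_indicator_one
        (s := {x | leftover rule N r x (k + 1) = A})
        (measurable_leftover rule N r (k + 1) (measurableSet_singleton A))]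
      refine lintegral_congr fun x => ?_
      simp only [leftover_succ rule N r _ hk]
      rfl
    · simpa only [leftover_succ_of_le rule N r _ hk, availLaw, dif_neg hk.not_gt] using ih A

lemma measurable_pay_leftover (i : Fin n) :
    Measurable fun x => pay (rule i) (x i).2 (leftover rule N r x i) (r i (x i).1) := by
  have h_pay : Measurable (Function.uncurry fun (A : Finset (Fin m)) (y : Fin N × Valuation m) =>
      pay (rule i) y.2 A (r i y.1)) :=
    measurable_from_prod_countable_right fun A =>
      measurable_from_prod_countable_right fun k : Fin N => measurable_pay (rule i) A (r i k)
  exact h_pay.comp ((measurable_leftover rule N r i).prodMk (measurable_pi_apply i))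

lemma revenue_levelPricing_eq_lintegral :
    (levelPricing N r).revenue rule D =
      ∫⁻ x, ∑ i, pay (rule i) (x i).2 (leftover rule N r x i) (r i (x i).1) ∂(jointLaw D N) := by
  let e := MeasurableEquiv.arrowProdEquivProdArrow (Fin N) (Valuation m) (Fin n)
  let totalPay : (Fin n → Fin N × Valuation m) → ℝ≥0∞ := fun x =>
    ∑ i, pay (rule i) (x i).2 (leftover rule N r x i) (r i (x i).1)
  have h_meas : Measurable totalPay :=
    Finset.measurable_sum _ fun i _ => measurable_pay_leftover rule N r i
  calc (levelPricing N r).revenue rule D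
      = ∫⁻ z, totalPay (e.symm z) ∂((Measure.pi fun _ => levelLaw N).prod (Measure.pi D)) :=
        (lintegral_prod (fun z => totalPay (e.symm z))
          (h_meas.comp e.symm.measurable).aemeasurable).symm
    _ = ∫⁻ x, totalPay (e.symm (e x)) ∂(jointLaw D N) :=
        ((measurePreserving_arrowProdEquivProdArrow (Fin N) (Valuation m) (Fin n)
          (fun _ => levelLaw N) D).lintegral_comp_emb e.measurableEmbedding _).symm

theorem revenue_levelPricing :
    (levelPricing N r).revenue rule D = ∑ i ∈ Finset.range n, buyerRev D rule N r i := by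
  rw [revenue_levelPricing_eq_lintegral,
    lintegral_finsetSum _ fun i _ => measurable_pay_leftover rule N r i, Finset.sum_range]
  refine Finset.sum_congr rfl fun i _ => ?_
  rw [lintegral_comp_leftover D rule N r i (g := fun A k v => pay (rule i) v A (r i k))
    fun A k => measurable_pay _ _ _]
  simp only [jointLaw_leftover_eq, buyerRev, i.isLt, dite_true]
  rfl

lemma sum_buyerRev_le_seqRev (k : ℕ) :
    ∑ i ∈ Finset.range k, buyerRev D rule N r i ≤ seqRev D rule :=
  calc ∑ i ∈ Finset.range k, buyerRev D rule N r i
      ≤ ∑ i ∈ Finset.range n, buyerRev D rule N r i :=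
        Finset.sum_le_sum_of_ne_zero fun _ _ hi =>
          Finset.mem_range.2 (by_contra fun h => hi (dif_neg h))
    _ = (levelPricing N r).revenue rule D := (revenue_levelPricing D rule N r).symm
    _ ≤ seqRev D rule := le_iSup (fun M : SeqItemPricing n m => M.revenue rule D) _

end LevelPricing

section Availability

variable {m : ℕ} (b : PurchaseRule m) (D : Measure (Valuation m)) (N : ℕ)

lemma PurchaseRule.measurableSet_mem_buy (A : Finset (Fin m)) (r : Fin m → ℝ≥0∞) (j : Fin m) :
    MeasurableSet {v | j ∈ b.buy v A r} :=
  b.measurable_buy_left A r (measurableSet_mem_finset j)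

/-- The probability that item `j` is sold to a buyer who faces the item prices `r`, when `a` is the
law of the available items. -/
def soldProb (a : Finset (Fin m) → ℝ≥0∞) (r : Fin m → ℝ≥0∞) (j : Fin m) : ℝ≥0∞ :=
  ∑ A, a A * D {v | j ∈ b.buy v A r}

lemma lintegral_pay (A : Finset (Fin m)) (r : Fin m → ℝ≥0∞) :
    ∫⁻ v, pay b v A r ∂D = ∑ j, r j * D {v | j ∈ b.buy v A r} := by
  have h_pay : ∀ v, pay b v A r = ∑ j, r j * Set.indicator {v | j ∈ b.buy v A r} 1 v := fun v => by
    simp only [pay, Set.indicator_apply, Set.mem_ofPred_eq, Pi.one_apply, mul_ite, mul_one,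
      mul_zero, Finset.sum_ite_mem, Finset.univ_inter]
  simp_rw [h_pay]
  rw [lintegral_finsetSum _ fun j _ =>
    (measurable_one.indicator (b.measurableSet_mem_buy A r j)).const_mul _]
  refine Finset.sum_congr rfl fun j _ => ?_
  rw [lintegral_const_mul _ (measurable_one.indicator (b.measurableSet_mem_buy A r j)),
    lintegral_indicator_one (b.measurableSet_mem_buy A r j)]

lemma sum_mul_lintegral_pay (a : Finset (Fin m) → ℝ≥0∞) (r : Fin m → ℝ≥0∞) :
    ∑ A, a A * ∫⁻ v, pay b v A r ∂D = ∑ j, r j * soldProb b D a r j := by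
  simp_rw [lintegral_pay, soldProb, Finset.mul_sum]
  rw [Finset.sum_comm]
  exact Finset.sum_congr rfl fun _ _ => Finset.sum_congr rfl fun _ _ => by ring

lemma sum_availStep_mul (r : ℕ → Fin m → ℝ≥0∞) (a φ : Finset (Fin m) → ℝ≥0∞) :
    ∑ A', availStep b D N r a A' * φ A' =
      ∑ A, a A * levelAvg N fun k => ∫⁻ v, φ (A \ b.buy v A (r k)) ∂D := by
  have h_meas : ∀ A k, Measurable fun v => A \ b.buy v A (r k) := fun A k =>
    (measurable_of_finite fun B : Finset (Fin m) => A \ B).comp (b.measurable_buy_left A (r k))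
  simp_rw [lintegral_comp_of_fintype D (h_meas _ _), ← sum_levelAvg, availStep, Finset.sum_mul,
    Finset.mul_sum]
  rw [Finset.sum_comm]
  refine Finset.sum_congr rfl fun A _ => Finset.sum_congr rfl fun A' _ => ?_
  rw [mul_assoc, mul_comm (levelAvg N _), ← levelAvg_mul_left]
  simp only [mul_comm (φ A')]

/-- The probability that item `j` is not available. -/
def unavail (a : Finset (Fin m) → ℝ≥0∞) (j : Fin m) : ℝ≥0∞ := ∑ A with j ∉ A, a A

lemma unavail_eq_sum_mul (a : Finset (Fin m) → ℝ≥0∞) (j : Fin m) :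
    unavail a j = ∑ A, a A * if j ∈ A then 0 else 1 := by
  simp only [unavail, Finset.sum_filter, mul_ite, mul_zero, mul_one, ite_not]

lemma unavail_le_sum (a : Finset (Fin m) → ℝ≥0∞) (j : Fin m) : unavail a j ≤ ∑ A, a A :=
  Finset.sum_le_sum_of_subset (Finset.filter_subset _ _)

lemma sum_ne_univ_eq_sum_mul (a : Finset (Fin m) → ℝ≥0∞) :
    ∑ A with A ≠ Finset.univ, a A = ∑ A, a A * if A = Finset.univ then 0 else 1 := by
  simp only [Finset.sum_filter, mul_ite, mul_zero, mul_one, ne_eq, ite_not]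

variable {N} [NeZero N]

lemma natCast_mul_lawRev (r : ℕ → Fin m → ℝ≥0∞) (a : Finset (Fin m) → ℝ≥0∞) :
    N * lawRev b D N r a = ∑ k ∈ Finset.range N, ∑ j, r k j * soldProb b D a (r k) j := by
  simp_rw [← sum_mul_lintegral_pay, lawRev, setRev, ← levelAvg_mul_left, sum_levelAvg,
    natCast_mul_levelAvg]

variable [IsProbabilityMeasure D]

lemma sum_availStep (r : ℕ → Fin m → ℝ≥0∞) (a : Finset (Fin m) → ℝ≥0∞) :
    ∑ A, availStep b D N r a A = ∑ A, a A := by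
  simpa only [Pi.one_apply, mul_one, lintegral_one, measure_univ, levelAvg_const]
    using sum_availStep_mul b D N r a 1

lemma unavail_availStep (r : ℕ → Fin m → ℝ≥0∞) (a : Finset (Fin m) → ℝ≥0∞) (j : Fin m) :
    unavail (availStep b D N r a) j =
      unavail a j + levelAvg N fun k => soldProb b D a (r k) j := by
  have h_lost : ∀ A k, ∫⁻ v, (if j ∈ A \ b.buy v A (r k) then (0 : ℝ≥0∞) else 1) ∂D
      = (if j ∈ A then 0 else 1) + D {v | j ∈ b.buy v A (r k)} := by
    intro A k
    have h_pointwise : ∀ v, (if j ∈ A \ b.buy v A (r k) then (0 : ℝ≥0∞) else 1)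
        = (if j ∈ A then 0 else 1) + {v | j ∈ b.buy v A (r k)}.indicator 1 v := fun v => by
      have h_sub : j ∈ b.buy v A (r k) → j ∈ A := fun h => b.buy_subset v A (r k) h
      by_cases hA : j ∈ A <;> by_cases hB : j ∈ b.buy v A (r k) <;> simp_all
    simp_rw [h_pointwise]
    rw [lintegral_add_left measurable_const, lintegral_const, measure_univ, mul_one,
      lintegral_indicator_one (b.measurableSet_mem_buy A (r k) j)]
  rw [unavail_eq_sum_mul, sum_availStep_mul, unavail_eq_sum_mul]
  simp_rw [h_lost, levelAvg_add, levelAvg_const, mul_add, Finset.sum_add_distrib, soldProb,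
    ← levelAvg_mul_left, sum_levelAvg]

lemma mul_lintegral_ne_univ_le (A : Finset (Fin m)) {r : Fin m → ℝ≥0∞} {f : ℝ≥0∞}
    (hr : ∀ j, f ≤ r j) :
    f * ∫⁻ v, (if A \ b.buy v A r = Finset.univ then (0 : ℝ≥0∞) else 1) ∂D
      ≤ f * (if A = Finset.univ then 0 else 1) + ∫⁻ v, pay b v A r ∂D := by
  have h_pointwise : ∀ v, f * (if A \ b.buy v A r = Finset.univ then (0 : ℝ≥0∞) else 1)
      ≤ f * (if A = Finset.univ then 0 else 1) + pay b v A r := fun v => by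
    rcases (b.buy v A r).eq_empty_or_nonempty with h_empty | ⟨j, hj⟩
    · simp [h_empty]
    · calc f * (if A \ b.buy v A r = Finset.univ then (0 : ℝ≥0∞) else 1)
          ≤ f := mul_le_of_le_one_right' (by split_ifs <;> simp)
        _ ≤ pay b v A r := (hr j).trans (Finset.single_le_sum (f := r) (fun _ _ => zero_le) hj)
        _ ≤ _ := le_add_self
  calc f * ∫⁻ v, (if A \ b.buy v A r = Finset.univ then (0 : ℝ≥0∞) else 1) ∂D
      = ∫⁻ v, f * (if A \ b.buy v A r = Finset.univ then (0 : ℝ≥0∞) else 1) ∂D :=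
        (lintegral_const_mul f ((measurable_of_finite fun B : Finset (Fin m) =>
          if A \ B = Finset.univ then (0 : ℝ≥0∞) else 1).comp
            (b.measurable_buy_left A r))).symm
    _ ≤ ∫⁻ v, (f * (if A = Finset.univ then 0 else 1) + pay b v A r) ∂D :=
        lintegral_mono h_pointwise
    _ = _ := by
        rw [lintegral_add_left measurable_const, lintegral_const, measure_univ, mul_one]

lemma mul_sum_ne_univ_availStep_le {r : ℕ → Fin m → ℝ≥0∞} (a : Finset (Fin m) → ℝ≥0∞)
    {f : ℝ≥0∞} (hr : ∀ k j, f ≤ r k j) :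
    f * ∑ A with A ≠ Finset.univ, availStep b D N r a A ≤
      f * ∑ A with A ≠ Finset.univ, a A + lawRev b D N r a := by
  rw [sum_ne_univ_eq_sum_mul, sum_availStep_mul, sum_ne_univ_eq_sum_mul, lawRev, Finset.mul_sum,
    Finset.mul_sum, ← Finset.sum_add_distrib]
  refine Finset.sum_le_sum fun A _ => ?_
  calc f * (a A * levelAvg N fun k =>
        ∫⁻ v, (if A \ b.buy v A (r k) = Finset.univ then (0 : ℝ≥0∞) else 1) ∂D)
      = a A * levelAvg N fun k =>
        f * ∫⁻ v, (if A \ b.buy v A (r k) = Finset.univ then (0 : ℝ≥0∞) else 1) ∂D := by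
        rw [levelAvg_mul_left, mul_left_comm]
    _ ≤ a A * levelAvg N fun k =>
        f * (if A = Finset.univ then 0 else 1) + ∫⁻ v, pay b v A (r k) ∂D := by
        gcongr
        exact levelAvg_mono fun k _ => mul_lintegral_ne_univ_le b D A (hr k)
    _ = f * (a A * if A = Finset.univ then 0 else 1) + a A * setRev b D N r A := by
        rw [levelAvg_add, levelAvg_const, mul_add, mul_left_comm, setRev]

end Availability

section AvailabilityLaw

variable {n m : ℕ} (D : Fin n → Measure (Valuation m)) (rule : Fin n → PurchaseRule m) {N : ℕ}
  [NeZero N] [∀ i, IsProbabilityMeasure (D i)]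

lemma sum_availLaw (r : Fin n → ℕ → Fin m → ℝ≥0∞) (i : ℕ) :
    ∑ A, availLaw D rule N r i A = 1 := by
  induction i with
  | zero => simp [availLaw]
  | succ i ih =>
    by_cases h : i < n
    · simp only [availLaw, dif_pos h, sum_availStep, ih]
    · simp only [availLaw, dif_neg h, ih]

end AvailabilityLaw

section OpportunityCosts

lemma two_rpow_le_one_add {x : ℝ≥0∞} (hx : x ≤ 1) : (2 : ℝ≥0∞) ^ x.toReal ≤ 1 + x := by
  lift x to ℝ≥0 using ne_top_of_le_ne_top ENNReal.one_ne_top hx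
  have h_bernoulli := rpow_one_add_le_one_add_mul_self (s := 1) (by norm_num) x.2
    (by exact_mod_cast hx : (x : ℝ) ≤ 1)
  rw [ENNReal.coe_toReal, ← ENNReal.coe_ofNat (n := 2), ← ENNReal.coe_rpow_of_nonneg _ x.coe_nonneg]
  norm_cast
  rw [← NNReal.coe_le_coe]
  push_cast
  norm_num at h_bernoulli
  exact h_bernoulli

variable {m : ℕ} (b : PurchaseRule m) (D : Measure (Valuation m)) (ρ : ℝ≥0∞)
  (a : Finset (Fin m) → ℝ≥0∞) (c : Fin m → ℝ≥0∞)

/-- The opportunity cost of item `j` after `k` levels, if it is `c j` initially: at each level,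
where the price of an item is its current opportunity cost plus `ρ * 2 ^ k`, the cost grows by a
factor of `1 + P`, where `P` is the probability that the item is sold at that level. -/
def levelCost : ℕ → Fin m → ℝ≥0∞
  | 0, j => c j
  | k + 1, j => levelCost k j * (1 + soldProb b D a (fun j => levelCost k j + ρ * 2 ^ k) j)

/-- The price of item `j` at level `k`. -/
def levelPrice (k : ℕ) (j : Fin m) : ℝ≥0∞ := levelCost b D ρ a c k j + ρ * 2 ^ k

lemma levelCost_succ (k : ℕ) (j : Fin m) :
    levelCost b D ρ a c (k + 1) j =
      levelCost b D ρ a c k j * (1 + soldProb b D a (levelPrice b D ρ a c k) j) := rfl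

lemma levelCost_eq_add_sum (k : ℕ) (j : Fin m) :
    levelCost b D ρ a c k j = c j + ∑ l ∈ Finset.range k,
      levelCost b D ρ a c l j * soldProb b D a (levelPrice b D ρ a c l) j := by
  induction k with
  | zero => simp [levelCost]
  | succ k ih => rw [Finset.sum_range_succ, ← add_assoc, ← ih, levelCost_succ, mul_add, mul_one]

lemma sum_levelCost_le (N : ℕ) [NeZero N] :
    ∑ j, levelCost b D ρ a c N j ≤ ∑ j, c j + N * lawRev b D N (levelPrice b D ρ a c) a := by
  simp_rw [levelCost_eq_add_sum b D ρ a c N, Finset.sum_add_distrib, natCast_mul_lawRev]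
  rw [Finset.sum_comm]
  gcongr
  exact le_self_add

variable [IsProbabilityMeasure D] {a} (ha : ∑ A, a A = 1)
include ha

lemma soldProb_le_one (r : Fin m → ℝ≥0∞) (j : Fin m) : soldProb b D a r j ≤ 1 :=
  calc soldProb b D a r j ≤ ∑ A, a A * 1 := by
        unfold soldProb
        gcongr
        exact prob_le_one
    _ = 1 := by simpa using ha

lemma levelPrice_succ_le (k : ℕ) (j : Fin m) :
    levelPrice b D ρ a c (k + 1) j ≤ 2 * levelPrice b D ρ a c k j :=
  calc levelPrice b D ρ a c (k + 1) j
      ≤ levelCost b D ρ a c k j * (1 + 1) + ρ * 2 ^ (k + 1) := by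
        rw [levelPrice, levelCost_succ]
        gcongr
        exact soldProb_le_one b D ha _ j
    _ = 2 * levelPrice b D ρ a c k j := by
        rw [levelPrice]
        ring

lemma mul_two_rpow_le_levelCost (k : ℕ) (j : Fin m) :
    c j * 2 ^ (∑ l ∈ Finset.range k, soldProb b D a (levelPrice b D ρ a c l) j).toReal
      ≤ levelCost b D ρ a c k j := by
  have h_fin : ∀ l, soldProb b D a (levelPrice b D ρ a c l) j ≠ ∞ := fun l =>
    ne_top_of_le_ne_top ENNReal.one_ne_top (soldProb_le_one b D ha _ j)
  induction k with
  | zero => simp [levelCost]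
  | succ k ih =>
    rw [Finset.sum_range_succ,
      ENNReal.toReal_add (ENNReal.sum_ne_top.2 fun l _ => h_fin l) (h_fin k),
      ENNReal.rpow_add _ _ (by norm_num) (by norm_num), ← mul_assoc, levelCost_succ]
    exact mul_le_mul' ih (two_rpow_le_one_add (soldProb_le_one b D ha _ j))

end OpportunityCosts

section CostPricing

variable {n m : ℕ} (D : Fin n → Measure (Valuation m)) (rule : Fin n → PurchaseRule m) (N : ℕ)
  (ρ : ℝ≥0∞)

/-- The law of the available items and the opportunity costs after the first `i` buyers. -/
def costState : ℕ → (Finset (Fin m) → ℝ≥0∞) × (Fin m → ℝ≥0∞)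
  | 0 => (Pi.single Finset.univ 1, fun _ => ρ)
  | i + 1 => if h : i < n then
      (availStep (rule ⟨i, h⟩) (D ⟨i, h⟩) N
        (levelPrice (rule ⟨i, h⟩) (D ⟨i, h⟩) ρ (costState i).1 (costState i).2) (costState i).1,
        levelCost (rule ⟨i, h⟩) (D ⟨i, h⟩) ρ (costState i).1 (costState i).2 N)
    else costState i

/-- The opportunity costs of the items after the first `i` buyers. -/
def cost (i : ℕ) : Fin m → ℝ≥0∞ := (costState D rule N ρ i).2

/-- The prices posted to buyer `i` at level `k`, derived from the opportunity costs. -/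
def costPrice (i : Fin n) : ℕ → Fin m → ℝ≥0∞ :=
  levelPrice (rule i) (D i) ρ (costState D rule N ρ i).1 (cost D rule N ρ i)

/-- The law of the available items after the first `i` buyers under the prices `costPrice`. -/
abbrev costLaw (i : ℕ) : Finset (Fin m) → ℝ≥0∞ :=
  availLaw D rule N (costPrice D rule N ρ) i

lemma costLaw_eq (i : ℕ) : costLaw D rule N ρ i = (costState D rule N ρ i).1 := by
  induction i with
  | zero => rfl
  | succ i ih =>
    by_cases h : i < n
    · simp only [availLaw, costState, dif_pos h, ih]
      rfl
    · simp only [availLaw, costState, dif_neg h, ih]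

lemma costPrice_eq (i : Fin n) : costPrice D rule N ρ i =
    levelPrice (rule i) (D i) ρ (costLaw D rule N ρ i) (cost D rule N ρ i) := by
  rw [costLaw_eq, costPrice]

lemma cost_succ {i : ℕ} (h : i < n) : cost D rule N ρ (i + 1) =
    levelCost (rule ⟨i, h⟩) (D ⟨i, h⟩) ρ (costLaw D rule N ρ i) (cost D rule N ρ i) N := by
  rw [costLaw_eq, cost, costState, dif_pos h]
  rfl

lemma cost_succ_of_le {i : ℕ} (h : n ≤ i) : cost D rule N ρ (i + 1) = cost D rule N ρ i := by
  rw [cost, costState, dif_neg h.not_gt, cost]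

variable [NeZero N]

lemma sum_cost_le (i : ℕ) : ∑ j, cost D rule N ρ i j ≤
    m * ρ + N * ∑ l ∈ Finset.range i, buyerRev D rule N (costPrice D rule N ρ) l := by
  induction i with
  | zero => simp [cost, costState]
  | succ i ih =>
    rw [Finset.sum_range_succ, mul_add, ← add_assoc]
    rcases lt_or_ge i n with h | h
    · rw [cost_succ D rule N ρ h, buyerRev, dif_pos h, costPrice_eq D rule N ρ ⟨i, h⟩]
      exact (sum_levelCost_le _ _ ρ _ _ N).trans (add_le_add_left ih _)
    · rw [cost_succ_of_le D rule N ρ h]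
      exact ih.trans le_self_add

variable [∀ i, IsProbabilityMeasure (D i)]

lemma sum_cost_le_seqRev (i : ℕ) : ∑ j, cost D rule N ρ i j ≤ m * ρ + N * seqRev D rule :=
  (sum_cost_le D rule N ρ i).trans (by gcongr; exact sum_buyerRev_le_seqRev D rule N _ i)

lemma unavail_costLaw_ne_top (i : ℕ) (j : Fin m) : unavail (costLaw D rule N ρ i) j ≠ ∞ :=
  ne_top_of_le_ne_top ENNReal.one_ne_top
    ((unavail_le_sum _ j).trans_eq (sum_availLaw D rule _ i))

lemma mul_two_rpow_le_cost (i : ℕ) (j : Fin m) :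
    ρ * 2 ^ (N * unavail (costLaw D rule N ρ i) j).toReal ≤ cost D rule N ρ i j := by
  induction i with
  | zero =>
    have h_avail : unavail (costLaw D rule N ρ 0) j = 0 := by
      simp only [unavail_eq_sum_mul, availLaw, Pi.single_apply, ite_mul, one_mul, zero_mul,
        Finset.sum_ite_eq', Finset.mem_univ, if_true]
    simp [h_avail, cost, costState]
  | succ i ih =>
    rcases lt_or_ge i n with h | h
    · have ha : ∑ A, costLaw D rule N ρ i A = 1 := sum_availLaw D rule _ i
      have h_sold : ∑ l ∈ Finset.range N, soldProb (rule ⟨i, h⟩) (D ⟨i, h⟩) (costLaw D rule N ρ i)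
          (costPrice D rule N ρ ⟨i, h⟩ l) j ≠ ∞ :=
        ENNReal.sum_ne_top.2 fun l _ =>
          ne_top_of_le_ne_top ENNReal.one_ne_top (soldProb_le_one _ _ ha _ j)
      rw [costLaw, availLaw, dif_pos h, unavail_availStep, mul_add, natCast_mul_levelAvg,
        ENNReal.toReal_add (ENNReal.mul_ne_top (ENNReal.natCast_ne_top N)
          (unavail_costLaw_ne_top D rule N ρ i j)) h_sold,
        ENNReal.rpow_add _ _ (by norm_num) (by norm_num), ← mul_assoc, cost_succ D rule N ρ h,
        costPrice_eq]
      exact (mul_le_mul_left ih _).trans (mul_two_rpow_le_levelCost _ _ ρ _ ha N j)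
    · rw [costLaw, availLaw, dif_neg h.not_gt, cost_succ_of_le D rule N ρ h]
      exact ih

theorem unavail_costLaw_le_half (i : ℕ) (j : Fin m)
    (h : m * ρ + N * seqRev D rule < ρ * 2 ^ ((N : ℝ) / 2)) :
    unavail (costLaw D rule N ρ i) j ≤ 2⁻¹ := by
  by_contra! h_unavail
  have h_exp : (N : ℝ) / 2 ≤ (N * unavail (costLaw D rule N ρ i) j).toReal := by
    have h_half := ENNReal.toReal_mono (unavail_costLaw_ne_top D rule N ρ i j) h_unavail.le
    rw [ENNReal.toReal_mul, ENNReal.toReal_natCast, div_eq_mul_inv]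
    gcongr
    simpa using h_half
  refine h.not_ge ?_
  calc ρ * 2 ^ ((N : ℝ) / 2)
      ≤ ρ * 2 ^ (N * unavail (costLaw D rule N ρ i) j).toReal := by
        gcongr
        norm_num
    _ ≤ cost D rule N ρ i j := mul_two_rpow_le_cost D rule N ρ i j
    _ ≤ ∑ j, cost D rule N ρ i j :=
        Finset.single_le_sum (f := cost D rule N ρ i) (fun _ _ => zero_le) (Finset.mem_univ j)
    _ ≤ m * ρ + N * seqRev D rule := sum_cost_le_seqRev D rule N ρ i

end CostPricing

section Lotteries

variable {m : ℕ}

lemma sum_lottery (ℓ : Lottery m) : ∑ S, ℓ S = 1 := by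
  rw [← tsum_fintype (L := .unconditional _)]
  exact ℓ.tsum_coe

lemma sum_lottery_mul_sum (ℓ : Lottery m) (x : Fin m → ℝ≥0∞) :
    ∑ S, ℓ S * ∑ j ∈ S, x j = ∑ j, x j * itemProb ℓ j := by
  have h_expand : ∀ S, ℓ S * ∑ j ∈ S, x j = ∑ j, if j ∈ S then x j * ℓ S else 0 := fun S => by
    rw [Finset.sum_ite_mem, Finset.univ_inter, Finset.mul_sum]
    exact Finset.sum_congr rfl fun _ _ => mul_comm _ _
  simp_rw [h_expand]
  rw [Finset.sum_comm]
  refine Finset.sum_congr rfl fun j _ => ?_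
  rw [itemProb, Finset.mul_sum, Finset.sum_filter]

/-- The expected value of a lottery as an extended nonnegative real; see `ofReal_lotteryValue`. -/
def lotteryEValue (v : Valuation m) (ℓ : Lottery m) : ℝ≥0∞ := ∑ S, ℓ S * (v.1 S : ℝ≥0∞)

lemma ofReal_lotteryValue (v : Valuation m) (ℓ : Lottery m) :
    ENNReal.ofReal (lotteryValue v ℓ) = lotteryEValue v ℓ := by
  rw [lotteryValue, ENNReal.ofReal_sum_of_nonneg fun _ _ => by positivity]
  refine Finset.sum_congr rfl fun S _ => ?_
  rw [ENNReal.ofReal_mul ENNReal.toReal_nonneg, ENNReal.ofReal_toReal (ℓ.apply_ne_top S),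
    ENNReal.ofReal_coe_nnreal]

end Lotteries

section CheapLotteries

variable {m : ℕ} {v : Valuation m} {a : Finset (Fin m) → ℝ≥0∞}

lemma min_value_le_sum_avail (hv : IsSubadditive v) (ha : ∑ A, a A = 1)
    (hu : ∀ j, unavail a j ≤ 2⁻¹) {s : ℕ} (hs : 2 * m ≤ 2 ^ s) (τ : ℝ≥0∞) (T : Finset (Fin m)) :
    min (v.1 T : ℝ≥0∞) τ ≤ 2 * s * ∑ A, a A * min (v.1 (T ∩ A) : ℝ≥0∞) τ := by
  refine le_two_mul_sum_inter (g := fun S => min (v.1 S : ℝ≥0∞) τ) (A := id) ?_ ?_ ?_ ?_ ha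
    (fun j _ => hu j) ?_
  · simp [v.2.1]
  · exact fun S S' h => min_le_min_right τ (by exact_mod_cast v.2.2 h)
  · intro S S'
    have h_sub : (v.1 (S ∪ S') : ℝ≥0∞) ≤ v.1 S + v.1 S' := by exact_mod_cast hv S S'
    exact (min_le_min_right τ h_sub).trans ((min_add_distrib' _ _ τ).trans_le (min_le_left _ _))
  · exact ne_top_of_le_ne_top ENNReal.coe_ne_top (min_le_left _ _)
  · exact (Nat.mul_le_mul_left 2 (card_finset_fin_le T)).trans hs

variable (b : PurchaseRule m) {r : ℕ → Fin m → ℝ≥0∞}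

lemma min_value_le_sum_pay (hv : IsSubadditive v) (ha : ∑ A, a A = 1)
    (hu : ∀ j, unavail a j ≤ 2⁻¹) {s : ℕ} (hs : 2 * m ≤ 2 ^ s)
    (hr : ∀ k j, r (k + 1) j ≤ 2 * r k j) (K : ℕ) {τ : ℝ≥0∞} (hτ : ∀ j, τ ≤ r K j)
    (T : Finset (Fin m)) :
    min (v.1 T : ℝ≥0∞) τ ≤ 2 * s *
      (∑ A, a A * ∑ k ∈ Finset.range (K + 1), pay b v A (r k) + ∑ j ∈ T, r 0 j) := by
  refine (min_value_le_sum_avail hv ha hu hs τ T).trans ?_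
  gcongr
  calc ∑ A, a A * min (v.1 (T ∩ A) : ℝ≥0∞) τ
      ≤ ∑ A, a A * (∑ k ∈ Finset.range (K + 1), pay b v A (r k) + ∑ j ∈ T, r 0 j) := by
        gcongr with A
        refine (min_value_le_sum_payments (fun k => b.isBundlePurchase v A (r k)) hr K hτ
          Finset.inter_subset_right).trans ?_
        rw [add_comm]
        gcongr ?_ + ?_
        · exact le_rfl
        · exact Finset.sum_le_sum_of_subset Finset.inter_subset_left
    _ = _ := by simp_rw [mul_add, Finset.sum_add_distrib, ← Finset.sum_mul, ha, one_mul]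

theorem price_le_sum_pay_add_cost (hv : IsSubadditive v) (ha : ∑ A, a A = 1)
    (hu : ∀ j, unavail a j ≤ 2⁻¹) {s : ℕ} (hs : 2 * m ≤ 2 ^ s)
    (hr : ∀ k j, r (k + 1) j ≤ 2 * r k j) (K : ℕ) {τ : ℝ≥0∞} (hτ : ∀ j, τ ≤ r K j)
    {ℓ : Lottery m} {p : ℝ≥0∞} (hp : p ≤ lotteryEValue v ℓ)
    (hpτ : p + 2 * s * ∑ j, r 0 j ≤ τ) (hτ_top : τ ≠ ∞) :
    p ≤ 2 * s * (∑ A, a A * ∑ k ∈ Finset.range (K + 1), pay b v A (r k)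
      + ∑ j, r 0 j * itemProb ℓ j) := by
  set Y := ∑ A, a A * ∑ k ∈ Finset.range (K + 1), pay b v A (r k)
  have h_min : ∀ T, min (v.1 T : ℝ≥0∞) τ ≤ 2 * s * (Y + ∑ j ∈ T, r 0 j) :=
    min_value_le_sum_pay b hv ha hu hs hr K hτ
  rcases le_total (v.1 Finset.univ : ℝ≥0∞) τ with h_small | h_large
  · have h_value : ∀ T, (v.1 T : ℝ≥0∞) ≤ 2 * s * (Y + ∑ j ∈ T, r 0 j) := fun T => by
      have h_le : (v.1 T : ℝ≥0∞) ≤ τ :=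
        le_trans (by exact_mod_cast v.2.2 (Finset.subset_univ T)) h_small
      exact (min_eq_left h_le).symm.trans_le (h_min T)
    calc p ≤ ∑ S, ℓ S * (2 * s * (Y + ∑ j ∈ S, r 0 j)) :=
          hp.trans (Finset.sum_le_sum fun S _ => mul_le_mul_right (h_value S) _)
      _ = 2 * s * ∑ S, (ℓ S * Y + ℓ S * ∑ j ∈ S, r 0 j) := by
          rw [Finset.mul_sum]
          exact Finset.sum_congr rfl fun S _ => by ring
      _ = _ := by
          rw [Finset.sum_add_distrib, ← Finset.sum_mul, sum_lottery, one_mul,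
            sum_lottery_mul_sum]
  · have h_univ := h_min Finset.univ
    rw [min_eq_right h_large, mul_add] at h_univ
    have h_cost : 2 * (s : ℝ≥0∞) * ∑ j, r 0 j ≠ ∞ :=
      ne_top_of_le_ne_top hτ_top (le_add_self.trans hpτ)
    exact (ENNReal.le_of_add_le_add_right h_cost (hpτ.trans h_univ)).trans
      (by gcongr; exact le_self_add)

end CheapLotteries

section Strategies

variable {m : ℕ}

lemma sum_map_mul {α β : Type*} [Fintype α] [Fintype β] (κ : PMF α) (g : α → β) (φ : β → ℝ≥0∞) :
    ∑ y, κ.map g y * φ y = ∑ x, κ x * φ (g x) := by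
  classical
  simp_rw [PMF.map_apply, tsum_fintype, Finset.sum_mul]
  rw [Finset.sum_comm]
  exact Finset.sum_congr rfl fun x _ => by simp

lemma sum_bind_mul {α β : Type*} [Fintype α] [Fintype β] (κ : PMF α) (o : α → PMF β)
    (φ : β → ℝ≥0∞) : ∑ y, κ.bind o y * φ y = ∑ x, κ x * ∑ y, o x y * φ y := by
  simp_rw [PMF.bind_apply, tsum_fintype, Finset.sum_mul, Finset.mul_sum, mul_assoc]
  exact Finset.sum_comm

lemma lotteryEValue_le_of_dominates {ℓ ℓ' : Lottery m} (h : Dominates ℓ ℓ') (v : Valuation m) :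
    lotteryEValue v ℓ' ≤ lotteryEValue v ℓ := by
  obtain ⟨κ, rfl, rfl, h_sub⟩ := h
  rw [lotteryEValue, lotteryEValue, sum_map_mul, sum_map_mul]
  refine Finset.sum_le_sum fun x _ => ?_
  by_cases hx : κ x = 0
  · simp [hx]
  · gcongr
    exact v.2.2 (h_sub x ((PMF.mem_support_iff _ _).2 hx))

lemma itemProb_add (ℓ : Lottery m) (j : Fin m) : itemProb ℓ j + ∑ S with j ∉ S, ℓ S = 1 := by
  rw [← sum_lottery ℓ, itemProb, Finset.sum_filter_add_sum_filter_not]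

lemma itemProb_le_one (ℓ : Lottery m) (j : Fin m) : itemProb ℓ j ≤ 1 :=
  itemProb_add ℓ j ▸ le_self_add

lemma itemProb_ne_top (ℓ : Lottery m) (j : Fin m) : itemProb ℓ j ≠ ∞ :=
  ne_top_of_le_ne_top ENNReal.one_ne_top (itemProb_le_one ℓ j)

lemma sum_notMem_lt_one {ℓ : Lottery m} {j : Fin m} (h : itemProb ℓ j ≠ 0) :
    ∑ S with j ∉ S, ℓ S < 1 := by
  have h_add := itemProb_add ℓ j
  rw [← h_add, add_comm]
  exact ENNReal.lt_add_right (ne_top_of_le_ne_top ENNReal.one_ne_top (h_add ▸ le_add_self)) h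

/-- The probability that a strategy does not obtain all items of `S`. -/
def Strategy.miss (s : Strategy m) (S : Finset (Fin m)) : ℝ≥0∞ :=
  ∑ T, s.outcome T * if S ⊆ T then 0 else 1

lemma Strategy.miss_mono (s : Strategy m) {S S' : Finset (Fin m)} (h : S ⊆ S') :
    s.miss S ≤ s.miss S' := by
  unfold Strategy.miss
  gcongr with T
  by_cases hT : S' ⊆ T
  · simp [hT, h.trans hT]
  · simp only [hT, if_false]
    split_ifs <;> simp

lemma Strategy.miss_le_one (s : Strategy m) (S : Finset (Fin m)) : s.miss S ≤ 1 := by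
  rw [← sum_lottery s.outcome]
  exact Finset.sum_le_sum fun T _ => mul_le_of_le_one_right' (by split_ifs <;> simp)

lemma Strategy.miss_buy (ℓ : Lottery m) (next : Finset (Fin m) → Strategy m)
    (S : Finset (Fin m)) :
    (Strategy.buy ℓ next).miss S = ∑ T, ℓ T * (next T).miss (S \ T) := by
  simp only [Strategy.miss, Strategy.outcome, sum_bind_mul, sum_map_mul, sdiff_le_iff,
    Finset.sup_eq_union]

lemma Strategy.value_le (s : Strategy m) (v : Valuation m) (S : Finset (Fin m)) :
    (v.1 S : ℝ≥0∞) ≤ lotteryEValue v s.outcome + s.miss S * v.1 S := by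
  rw [Strategy.miss, lotteryEValue, Finset.sum_mul, ← Finset.sum_add_distrib]
  calc (v.1 S : ℝ≥0∞) = ∑ T, s.outcome T * (v.1 S : ℝ≥0∞) := by
        rw [← Finset.sum_mul, sum_lottery, one_mul]
    _ ≤ _ := Finset.sum_le_sum fun T _ => by
        by_cases hT : S ⊆ T
        · have h_le : (v.1 S : ℝ≥0∞) ≤ v.1 T := by exact_mod_cast v.2.2 hT
          simpa only [hT, if_true, mul_zero, zero_mul, add_zero] using mul_le_mul_right h_le _
        · simp [hT]

/-- The strategy that buys the lottery `ℓ` until item `j` is obtained, but at most `R` times, and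
then goes on with `s`. -/
def buyUntil (ℓ : Lottery m) (j : Fin m) : ℕ → Strategy m → Strategy m
  | 0, s => s
  | R + 1, s => .buy ℓ fun S => if j ∈ S then s else buyUntil ℓ j R s

lemma cost_buyUntil_le (p : PriceMenu m) {ℓ : Lottery m} {j : Fin m} {q : ℝ≥0∞}
    (hq : p.price ℓ ≤ q * itemProb ℓ j) (R : ℕ) (s : Strategy m) :
    (buyUntil ℓ j R s).cost p ≤ q + s.cost p := by
  induction R with
  | zero => exact le_add_self
  | succ R ih =>
    rw [buyUntil, Strategy.cost]
    calc p.price ℓ + ∑ S, ℓ S * (if j ∈ S then s else buyUntil ℓ j R s).cost p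
        ≤ q * itemProb ℓ j + ∑ S, (ℓ S * s.cost p + q * if j ∉ S then ℓ S else 0) := by
          gcongr with S
          by_cases hj : j ∈ S
          · simp [hj]
          · simp only [hj, if_false, not_false_eq_true, if_true]
            exact (mul_le_mul_right ih _).trans_eq (by ring)
      _ = q * (itemProb ℓ j + ∑ S with j ∉ S, ℓ S) + s.cost p := by
          rw [Finset.sum_add_distrib, ← Finset.sum_mul, sum_lottery, one_mul, ← Finset.mul_sum,
            ← Finset.sum_filter]
          ring
      _ = q + s.cost p := by rw [itemProb_add, mul_one]

lemma miss_buyUntil_le (ℓ : Lottery m) (j : Fin m) (R : ℕ) (s : Strategy m) (S : Finset (Fin m)) :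
    (buyUntil ℓ j R s).miss S ≤ s.miss (S.erase j) + (∑ T with j ∉ T, ℓ T) ^ R := by
  induction R with
  | zero => exact (s.miss_le_one S).trans (by simp)
  | succ R ih =>
    have h_next : ∀ T, (if j ∈ T then s else buyUntil ℓ j R s).miss (S \ T) ≤
        s.miss (S.erase j) + (∑ T with j ∉ T, ℓ T) ^ R * if j ∉ T then 1 else 0 := fun T => by
      by_cases hj : j ∈ T
      · simp only [hj, if_true, not_true_eq_false, if_false, mul_zero, add_zero,
          ← Finset.sdiff_singleton_eq_erase]
        exact s.miss_mono (Finset.sdiff_subset_sdiff subset_rfl (by simpa using hj))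
      · simp only [hj, if_false, not_false_eq_true, if_true, mul_one]
        exact (Strategy.miss_mono _ Finset.sdiff_subset).trans ih
    rw [buyUntil, Strategy.miss_buy]
    refine (Finset.sum_le_sum fun T _ => mul_le_mul_right (h_next T) _).trans_eq ?_
    simp_rw [mul_add, Finset.sum_add_distrib, ← Finset.sum_mul, sum_lottery, one_mul,
      mul_left_comm (ℓ _), ← Finset.mul_sum, mul_ite, mul_one, mul_zero, ← Finset.sum_filter]
    rw [pow_succ]

lemma exists_strategy_cost_le_miss_le (p : PriceMenu m) {q : Fin m → ℝ≥0∞}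
    (hq : ∀ j, ∃ ℓ, itemProb ℓ j ≠ 0 ∧ p.price ℓ ≤ q j * itemProb ℓ j) {ε : ℝ≥0∞} (hε : ε ≠ 0)
    (S : Finset (Fin m)) : ∃ s : Strategy m, s.cost p ≤ ∑ j ∈ S, q j ∧ s.miss S ≤ S.card * ε := by
  induction S using Finset.induction with
  | empty => exact ⟨.done, by simp [Strategy.cost], by simp [Strategy.miss]⟩
  | insert j S hj ih =>
    obtain ⟨s, hs_cost, hs_miss⟩ := ih
    obtain ⟨ℓ, hℓ, hℓ_price⟩ := hq j
    obtain ⟨R, hR⟩ := ((ENNReal.tendsto_pow_atTop_nhds_zero_of_lt_one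
      (sum_notMem_lt_one hℓ)).eventually_le_const hε.bot_lt).exists
    refine ⟨buyUntil ℓ j R s, ?_, ?_⟩
    · rw [Finset.sum_insert hj]
      exact (cost_buyUntil_le p hℓ_price R s).trans (by gcongr)
    · rw [Finset.card_insert_of_notMem hj, Nat.cast_succ, add_one_mul]
      refine (miss_buyUntil_le ℓ j R s _).trans ?_
      rw [Finset.erase_insert hj]
      gcongr

end Strategies

section BuyManyMenus

variable {m : ℕ} {p : PriceMenu m} {v : Valuation m} {ℓ : Lottery m}

lemma PriceMenu.IsPurchase.price_le (h : p.IsPurchase v ℓ) :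
    p.price ℓ ≤ lotteryEValue v ℓ := by
  have h_utility := h.2.1 (PMF.pure ∅) (by simp [p.price_empty])
  have h_value : lotteryValue v (PMF.pure ∅) = 0 :=
    Finset.sum_eq_zero fun S _ => by
      by_cases hS : S = ∅ <;> simp [hS, v.2.1]
  simp only [PriceMenu.utility, h_value, p.price_empty, ENNReal.toReal_zero, sub_zero,
    sub_nonneg] at h_utility
  rw [← ofReal_lotteryValue, ← ENNReal.ofReal_toReal h.1]
  exact ENNReal.ofReal_le_ofReal h_utility

lemma PriceMenu.IsPurchase.value_le (h : p.IsPurchase v ℓ) (ℓ' : Lottery m) :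
    lotteryEValue v ℓ' ≤ p.price ℓ' + (lotteryEValue v ℓ - p.price ℓ) := by
  by_cases hfin : p.price ℓ' = ∞
  · simp [hfin]
  have h_utility := h.2.1 ℓ' hfin
  simp only [PriceMenu.utility] at h_utility
  rw [← ofReal_lotteryValue, ← ofReal_lotteryValue, ← ENNReal.ofReal_toReal hfin,
    ← ENNReal.ofReal_toReal h.1, ← ENNReal.ofReal_sub _ ENNReal.toReal_nonneg]
  refine le_trans (ENNReal.ofReal_le_ofReal ?_) ENNReal.ofReal_add_le
  linarith

/-- The cheapest price per unit of probability at which a menu sells item `j`. -/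
def PriceMenu.unitPrice (p : PriceMenu m) (j : Fin m) : ℝ≥0∞ :=
  ⨅ (ℓ : Lottery m) (_ : itemProb ℓ j ≠ 0), p.price ℓ / itemProb ℓ j

lemma PriceMenu.unitPrice_mul_le (p : PriceMenu m) (ℓ : Lottery m) (j : Fin m) :
    p.unitPrice j * itemProb ℓ j ≤ p.price ℓ := by
  by_cases h : itemProb ℓ j = 0
  · simp [h]
  · exact (ENNReal.le_div_iff_mul_le (Or.inl h) (Or.inl (itemProb_ne_top ℓ j))).1
      (iInf₂_le (f := fun (ℓ : Lottery m) (_ : itemProb ℓ j ≠ 0) => p.price ℓ / itemProb ℓ j) ℓ h)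

lemma PriceMenu.exists_price_le_mul_itemProb (p : PriceMenu m) (j : Fin m) {ε : ℝ≥0∞}
    (hε : ε ≠ 0) :
    ∃ ℓ, itemProb ℓ j ≠ 0 ∧ p.price ℓ ≤ (p.unitPrice j + ε) * itemProb ℓ j := by
  by_cases h_top : p.unitPrice j = ∞
  · have h_sure : itemProb (PMF.pure {j}) j ≠ 0 := by
      simp [itemProb, PMF.pure_apply]
    exact ⟨PMF.pure {j}, h_sure, by simp [h_top, ENNReal.top_mul h_sure]⟩
  · obtain ⟨ℓ, hℓ⟩ := iInf_lt_iff.1 (ENNReal.lt_add_right h_top hε)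
    obtain ⟨h_pos, h_lt⟩ := iInf_lt_iff.1 hℓ
    exact ⟨ℓ, h_pos, (ENNReal.div_le_iff h_pos (itemProb_ne_top ℓ j)).1 h_lt.le⟩

theorem PriceMenu.IsPurchase.value_le_unitPrice (h : p.IsPurchase v ℓ) (hp : p ∈ buyManyMenus m)
    (S : Finset (Fin m)) :
    (v.1 S : ℝ≥0∞) ≤ ∑ j ∈ S, p.unitPrice j + (lotteryEValue v ℓ - p.price ℓ) := by
  set X := ∑ j ∈ S, p.unitPrice j + (lotteryEValue v ℓ - p.price ℓ)
  set c : ℝ≥0∞ := S.card + S.card * v.1 S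
  have h_approx : ∀ ε : ℝ≥0∞, 0 < ε → (v.1 S : ℝ≥0∞) ≤ X + ε * c := fun ε hε => by
    obtain ⟨s, hs_cost, hs_miss⟩ := exists_strategy_cost_le_miss_le p
      (fun j => p.exists_price_le_mul_itemProb j hε.ne') hε.ne' S
    obtain ⟨ℓ', h_dom, h_price⟩ := hp s
    calc (v.1 S : ℝ≥0∞) ≤ lotteryEValue v s.outcome + s.miss S * v.1 S := s.value_le v S
      _ ≤ p.price ℓ' + (lotteryEValue v ℓ - p.price ℓ) + s.miss S * v.1 S := by
          gcongr
          exact (lotteryEValue_le_of_dominates h_dom v).trans (h.value_le ℓ')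
      _ ≤ ∑ j ∈ S, (p.unitPrice j + ε) + (lotteryEValue v ℓ - p.price ℓ)
            + S.card * ε * v.1 S := by
          gcongr
          exact h_price.trans hs_cost
      _ = X + ε * c := by
          rw [Finset.sum_add_distrib, Finset.sum_const, nsmul_eq_mul]
          ring
  have h_lim : Filter.Tendsto (fun ε => X + ε * c) (nhdsWithin 0 (Set.Ioi 0)) (nhds X) := by
    have hc : c ≠ ∞ := by finiteness
    have h_lim_nhds := (ENNReal.Tendsto.mul_const (Filter.tendsto_id (x := nhds 0))
      (Or.inr hc)).const_add X
    simp only [id, zero_mul, add_zero] at h_lim_nhds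
    exact h_lim_nhds.mono_left nhdsWithin_le_nhds
  exact ge_of_tendsto h_lim (eventually_mem_nhdsWithin.mono h_approx)

variable (b : PurchaseRule m)

lemma PriceMenu.IsPurchase.value_le_sum_pay_add_utility (h : p.IsPurchase v ℓ)
    (hp : p ∈ buyManyMenus m) {r : ℕ → Fin m → ℝ≥0∞} (hr : ∀ k j, r (k + 1) j ≤ 2 * r k j) {K : ℕ}
    (hK : ∀ j, p.unitPrice j ≤ r K j) (T : Finset (Fin m)) :
    (v.1 T : ℝ≥0∞) ≤ ∑ j ∈ T, r 0 j + ∑ k ∈ Finset.range K, pay b v Finset.univ (r k)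
      + (lotteryEValue v ℓ - p.price ℓ) := by
  refine (value_le_sum_payments_add_utility (fun k => b.isBundlePurchase v Finset.univ (r k)) hr K
    (Finset.subset_univ T)).trans ?_
  gcongr ?_ + ?_
  · exact le_rfl
  · refine tsub_le_iff_left.2 ((h.value_le_unitPrice hp _).trans ?_)
    gcongr
    exact hK _

lemma PriceMenu.IsPurchase.price_le_cost_add_sum_pay (h : p.IsPurchase v ℓ)
    (hp : p ∈ buyManyMenus m) {r : ℕ → Fin m → ℝ≥0∞} (hr : ∀ k j, r (k + 1) j ≤ 2 * r k j) {K : ℕ}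
    (hK : ∀ j, p.unitPrice j ≤ r K j) :
    p.price ℓ ≤ ∑ j, r 0 j * itemProb ℓ j + ∑ k ∈ Finset.range K, pay b v Finset.univ (r k) := by
  set Y := ∑ k ∈ Finset.range K, pay b v Finset.univ (r k)
  set V := lotteryEValue v ℓ
  have hV : V ≠ ∞ := ENNReal.sum_ne_top.2 fun T _ =>
    ENNReal.mul_ne_top (ℓ.apply_ne_top T) ENNReal.coe_ne_top
  have h_utility : V - p.price ℓ ≠ ∞ := ne_top_of_le_ne_top hV tsub_le_self
  refine ENNReal.le_of_add_le_add_right h_utility ?_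
  calc p.price ℓ + (V - p.price ℓ) = V := add_tsub_cancel_of_le h.price_le
    _ ≤ ∑ T, ℓ T * (∑ j ∈ T, r 0 j + Y + (V - p.price ℓ)) :=
        Finset.sum_le_sum fun T _ =>
          mul_le_mul_right (h.value_le_sum_pay_add_utility b hp hr hK T) _
    _ = ∑ j, r 0 j * itemProb ℓ j + Y + (V - p.price ℓ) := by
        simp_rw [mul_add, Finset.sum_add_distrib, ← Finset.sum_mul, sum_lottery, one_mul,
          sum_lottery_mul_sum]

lemma sum_floor_mul_itemProb_le (p : PriceMenu m) (ℓ : Lottery m) {f β : ℝ≥0∞}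
    (hβ : 4 * m * β ≤ 1) (hf : 4 * (f * ∑ j, itemProb ℓ j) ≤ p.price ℓ) :
    ∑ j, (f + β * p.unitPrice j) * itemProb ℓ j ≤ p.price ℓ / 2 := by
  have h_unit : ∑ j, p.unitPrice j * itemProb ℓ j ≤ m * p.price ℓ :=
    (Finset.sum_le_sum fun j _ => p.unitPrice_mul_le ℓ j).trans (by simp)
  have h_four : 4 * ∑ j, (f + β * p.unitPrice j) * itemProb ℓ j ≤ 2 * p.price ℓ :=
    calc 4 * ∑ j, (f + β * p.unitPrice j) * itemProb ℓ j
        = 4 * (f * ∑ j, itemProb ℓ j) + 4 * (β * ∑ j, p.unitPrice j * itemProb ℓ j) := by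
          simp only [add_mul, Finset.sum_add_distrib, Finset.mul_sum, mul_add, mul_assoc]
      _ ≤ p.price ℓ + 4 * (β * (m * p.price ℓ)) := by gcongr
      _ = p.price ℓ + 4 * m * β * p.price ℓ := by ring
      _ ≤ p.price ℓ + 1 * p.price ℓ := by gcongr
      _ = 2 * p.price ℓ := by ring
  rw [ENNReal.le_div_iff_mul_le (by simp) (by simp), mul_comm]
  rwa [show (4 : ℝ≥0∞) = 2 * 2 by norm_num, mul_assoc,
    ENNReal.mul_le_mul_iff_right (by simp) (by simp)] at h_four

/-- Item prices proportional to `q` that double from each level to the next, down to `2⁻ᴺ q`, all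
raised by the floor `f`. -/
def floorPrice (N : ℕ) (f : ℝ≥0∞) (q : Fin m → ℝ≥0∞) (k : ℕ) (j : Fin m) : ℝ≥0∞ :=
  f + (2 ^ N)⁻¹ * 2 ^ k * q j

theorem PriceMenu.IsPurchase.price_le_sum_pay_floorPrice (h : p.IsPurchase v ℓ)
    (hp : p ∈ buyManyMenus m) {N : ℕ} (hN : 4 * m ≤ 2 ^ N) {f : ℝ≥0∞}
    (hf : 4 * (f * ∑ j, itemProb ℓ j) ≤ p.price ℓ) :
    p.price ℓ ≤
      2 * ∑ k ∈ Finset.range N, pay b v Finset.univ (floorPrice N f p.unitPrice k) := by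
  set Y := ∑ k ∈ Finset.range N, pay b v Finset.univ (floorPrice N f p.unitPrice k)
  have h_double : ∀ k j, floorPrice N f p.unitPrice (k + 1) j
      ≤ 2 * floorPrice N f p.unitPrice k j := fun k j => by
    rw [floorPrice, floorPrice, mul_add, pow_succ]
    gcongr ?_ + ?_
    · exact le_mul_of_one_le_left' one_le_two
    · exact le_of_eq (by ring)
  have h_top : ∀ j, p.unitPrice j ≤ floorPrice N f p.unitPrice N j := fun j => by
    rw [floorPrice, ENNReal.inv_mul_cancel (by simp) (by simp), one_mul]
    exact le_add_self
  have h_cost : ∑ j, floorPrice N f p.unitPrice 0 j * itemProb ℓ j ≤ p.price ℓ / 2 := by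
    simp only [floorPrice, pow_zero, mul_one]
    refine sum_floor_mul_itemProb_le p ℓ ?_ hf
    rw [← div_eq_mul_inv]
    exact ENNReal.div_le_of_le_mul (by rw [one_mul]; exact_mod_cast hN)
  have h_half : p.price ℓ / 2 + p.price ℓ / 2 ≤ p.price ℓ / 2 + Y := by
    rw [ENNReal.add_halves]
    exact (h.price_le_cost_add_sum_pay b hp h_double h_top).trans (by gcongr)
  calc p.price ℓ = 2 * (p.price ℓ / 2) := by rw [two_mul, ENNReal.add_halves]
    _ ≤ 2 * Y := by
        gcongr
        exact ENNReal.le_of_add_le_add_left (ENNReal.div_lt_top h.1 (by simp)).ne h_half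

end BuyManyMenus

section FloorPrices

variable {n m : ℕ} (D : Fin n → Measure (Valuation m)) (rule : Fin n → PurchaseRule m) (N : ℕ)
  [NeZero N] [∀ i, IsProbabilityMeasure (D i)] {f : ℝ≥0∞}

section

variable (r : Fin n → ℕ → Fin m → ℝ≥0∞) (hr : ∀ i k j, f ≤ r i k j)
include hr

lemma mul_sum_ne_univ_availLaw_le (i : ℕ) :
    f * ∑ A with A ≠ Finset.univ, availLaw D rule N r i A ≤
      ∑ l ∈ Finset.range i, buyerRev D rule N r l := by
  induction i with
  | zero =>
    have h_zero : ∑ A with A ≠ Finset.univ, availLaw D rule N r 0 A = 0 :=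
      Finset.sum_eq_zero fun A hA => Pi.single_eq_of_ne (Finset.mem_filter.1 hA).2 _
    simp [h_zero]
  | succ i ih =>
    rw [Finset.sum_range_succ]
    by_cases h : i < n
    · rw [buyerRev, dif_pos h, availLaw, dif_pos h]
      exact (mul_sum_ne_univ_availStep_le _ _ _ (hr ⟨i, h⟩)).trans (add_le_add_left ih _)
    · simpa only [availLaw, buyerRev, dif_neg h, add_zero] using ih

lemma half_le_availLaw_univ (hf : 2 * seqRev D rule < f) (i : ℕ) :
    2⁻¹ ≤ availLaw D rule N r i Finset.univ := by
  have h_rest : ∑ A with A ≠ Finset.univ, availLaw D rule N r i A ≤ 2⁻¹ := by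
    by_contra! h
    refine hf.not_ge ?_
    calc f = 2 * (f * 2⁻¹) := by
          rw [mul_left_comm, ENNReal.mul_inv_cancel two_ne_zero ENNReal.ofNat_ne_top, mul_one]
      _ ≤ 2 * (f * ∑ A with A ≠ Finset.univ, availLaw D rule N r i A) := by gcongr
      _ ≤ 2 * seqRev D rule := by
          gcongr
          exact (mul_sum_ne_univ_availLaw_le D rule N r hr i).trans
            (sum_buyerRev_le_seqRev D rule N r i)
  have h_total := sum_availLaw D rule (N := N) r i
  rw [← Finset.sum_filter_add_sum_filter_not Finset.univ (fun A => A ≠ Finset.univ)] at h_total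
  simp only [not_not, Finset.filter_eq', Finset.mem_univ, if_true, Finset.sum_singleton] at h_total
  refine ENNReal.le_of_add_le_add_left (a := 2⁻¹) (by simp) ?_
  calc (2⁻¹ + 2⁻¹ : ℝ≥0∞)
      = ∑ A with A ≠ Finset.univ, availLaw D rule N r i A + availLaw D rule N r i Finset.univ :=
        ENNReal.inv_two_add_inv_two.trans h_total.symm
    _ ≤ 2⁻¹ + availLaw D rule N r i Finset.univ := by gcongr

lemma sum_setRev_univ_le (hf : 2 * seqRev D rule < f) :
    ∑ i, setRev (rule i) (D i) N (r i) Finset.univ ≤ 2 * seqRev D rule := by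
  have h_buyer : ∀ i : Fin n,
      setRev (rule i) (D i) N (r i) Finset.univ ≤ 2 * buyerRev D rule N r i := fun i =>
    calc setRev (rule i) (D i) N (r i) Finset.univ
        = 2 * (2⁻¹ * setRev (rule i) (D i) N (r i) Finset.univ) := by
          rw [← mul_assoc, ENNReal.mul_inv_cancel two_ne_zero ENNReal.ofNat_ne_top, one_mul]
      _ ≤ 2 * (availLaw D rule N r i Finset.univ
            * setRev (rule i) (D i) N (r i) Finset.univ) := by
          gcongr
          exact half_le_availLaw_univ D rule N r hr hf i
      _ ≤ 2 * buyerRev D rule N r i := by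
          rw [buyerRev, dif_pos i.isLt]
          gcongr
          exact Finset.single_le_sum
            (f := fun A => availLaw D rule N r i A * setRev (rule i) (D i) N (r i) A)
            (fun _ _ => zero_le) (Finset.mem_univ _)
  calc ∑ i, setRev (rule i) (D i) N (r i) Finset.univ
      ≤ ∑ i : Fin n, 2 * buyerRev D rule N r i := Finset.sum_le_sum fun i _ => h_buyer i
    _ = 2 * ∑ i ∈ Finset.range n, buyerRev D rule N r i := by
        rw [← Finset.mul_sum, Finset.sum_range]
    _ ≤ 2 * seqRev D rule := by
        gcongr
        exact sum_buyerRev_le_seqRev D rule N r n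

end

/-- The best expected payment at a uniformly random level of prices with floor `f`, if all items
are available. -/
def floorRev (b : PurchaseRule m) (D : Measure (Valuation m)) (N : ℕ) (f : ℝ≥0∞) : ℝ≥0∞ :=
  ⨆ q : Fin m → ℝ≥0∞, setRev b D N (floorPrice N f q) Finset.univ

lemma sum_iSup_le_of_forall_sum_le {ι κ : Type*} [Fintype ι] {g : ι → κ → ℝ≥0∞} {B : ℝ≥0∞}
    [Nonempty κ] (h : ∀ q : ι → κ, ∑ i, g i (q i) ≤ B) : ∑ i, ⨆ x, g i x ≤ B := by
  have h_eval : ∀ i, ⨆ x, g i x = ⨆ q : ι → κ, g i (q i) := fun i =>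
    (Function.Surjective.iSup_comp (f := fun q : ι → κ => q i) (Function.surjective_eval i)
      (g i)).symm
  have h_directed : ∀ q q' : ι → κ,
      ∃ q'' : ι → κ, ∀ i, g i (q i) ≤ g i (q'' i) ∧ g i (q' i) ≤ g i (q'' i) := fun q q' => by
    have h_max : ∀ i, ∃ x, g i (q i) ≤ g i x ∧ g i (q' i) ≤ g i x := fun i =>
      (le_total (g i (q i)) (g i (q' i))).elim (fun h => ⟨q' i, h, le_rfl⟩)
        fun h => ⟨q i, le_rfl, h⟩
    choose q'' hq'' using h_max
    exact ⟨q'', hq''⟩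
  simp_rw [h_eval]
  rw [ENNReal.finsetSum_iSup h_directed]
  exact iSup_le h

theorem sum_floorRev_le (hf : 2 * seqRev D rule < f) :
    ∑ i, floorRev (rule i) (D i) N f ≤ 2 * seqRev D rule :=
  sum_iSup_le_of_forall_sum_le fun q =>
    sum_setRev_univ_le D rule N (fun i => floorPrice N f (q i)) (fun _ _ _ => le_self_add) hf

end FloorPrices

section SingleBuyer

variable {m : ℕ} {D : Measure (Valuation m)}

lemma lintegral_sum_pay (b : PurchaseRule m) (N : ℕ) [NeZero N] (r : ℕ → Fin m → ℝ≥0∞)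
    (A : Finset (Fin m)) :
    ∫⁻ v, ∑ k ∈ Finset.range N, pay b v A (r k) ∂D = N * setRev b D N r A := by
  rw [lintegral_finsetSum _ fun k _ => measurable_pay b A (r k), setRev, natCast_mul_levelAvg]

lemma lintegral_sum_mul_sum_pay (b : PurchaseRule m) (N : ℕ) [NeZero N] (r : ℕ → Fin m → ℝ≥0∞)
    (a : Finset (Fin m) → ℝ≥0∞) :
    ∫⁻ v, ∑ A, a A * ∑ k ∈ Finset.range N, pay b v A (r k) ∂D = N * lawRev b D N r a := by
  have h_meas : ∀ A, Measurable fun v => ∑ k ∈ Finset.range N, pay b v A (r k) := fun A =>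
    Finset.measurable_sum _ fun k _ => measurable_pay b A (r k)
  rw [lintegral_finsetSum _ fun A _ => (h_meas A).const_mul _, lawRev, Finset.mul_sum]
  refine Finset.sum_congr rfl fun A _ => ?_
  rw [lintegral_const_mul _ (h_meas A), lintegral_sum_pay, mul_left_comm]

lemma Mechanism.lintegral_sum_mul_itemProb {𝒞 : Set (PriceMenu m)} (M : Mechanism D 𝒞)
    (c : Fin m → ℝ≥0∞) :
    ∫⁻ v, ∑ j, c j * itemProb (M.choice v) j ∂D = ∑ j, c j * M.alloc j := by
  have h_meas : ∀ j, AEMeasurable (fun v => itemProb (M.choice v) j) D := fun j =>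
    Finset.aemeasurable_fun_sum _ fun S _ => M.aemeasurable_choice S
  rw [lintegral_finsetSum' _ fun j _ => (h_meas j).const_mul _]
  exact Finset.sum_congr rfl fun j _ => lintegral_const_mul'' _ (h_meas j)

lemma Mechanism.measurable_alloc {𝒞 : Set (PriceMenu m)} (j : Fin m) :
    Measurable fun M : Mechanism D 𝒞 => M.alloc j :=
  (measurable_pi_apply j).comp
    (measurable_snd.comp (comap_measurable fun M : Mechanism D 𝒞 => (M.revenue, M.alloc)))

variable (b : PurchaseRule m) {a : Finset (Fin m) → ℝ≥0∞} (ha : ∑ A, a A = 1)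
  (hu : ∀ j, unavail a j ≤ 2⁻¹) {K : ℕ} (hK : 4 * m ≤ 2 ^ (K + 1)) {r : ℕ → Fin m → ℝ≥0∞}
  (hr : ∀ k j, r (k + 1) j ≤ 2 * r k j) {τ : ℝ≥0∞} (hτ : ∀ j, τ ≤ r K j) (hτ_top : τ ≠ ∞)
  {f : ℝ≥0∞} (hf : 4 * (f * m) + 2 * (K + 1 : ℕ) * ∑ j, r 0 j ≤ τ)
include ha hu hK hr hτ hτ_top hf

lemma PriceMenu.IsPurchase.price_le_sum_pay_add_cost_add_sum_pay {p : PriceMenu m} {v : Valuation m}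
    {ℓ : Lottery m} (h : p.IsPurchase v ℓ) (hp : p ∈ buyManyMenus m) (hv : IsSubadditive v) :
    p.price ℓ ≤
      2 * (K + 1 : ℕ) * (∑ A, a A * ∑ k ∈ Finset.range (K + 1), pay b v A (r k)
        + ∑ j, r 0 j * itemProb ℓ j)
      + 2 * ∑ k ∈ Finset.range (K + 1),
          pay b v Finset.univ (floorPrice (K + 1) f p.unitPrice k) := by
  rcases le_total (4 * (f * ∑ j, itemProb ℓ j)) (p.price ℓ) with h_expensive | h_cheap
  · exact (h.price_le_sum_pay_floorPrice b hp hK h_expensive).trans le_add_self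
  · have h_price : p.price ℓ ≤ 4 * (f * m) := by
      refine h_cheap.trans ?_
      gcongr
      exact (Finset.sum_le_sum fun j _ => itemProb_le_one ℓ j).trans_eq (by simp)
    exact (price_le_sum_pay_add_cost b hv ha hu (by omega) hr K hτ h.price_le
      (le_trans (by gcongr) hf) hτ_top).trans le_self_add

lemma Mechanism.revenue_le (hD : ∀ᵐ v ∂D, IsSubadditive v) (M : Mechanism D (buyManyMenus m)) :
    M.revenue ≤
      2 * (K + 1 : ℕ) * ((K + 1 : ℕ) * lawRev b D (K + 1) r a + ∑ j, r 0 j * M.alloc j)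
      + 2 * ((K + 1 : ℕ) * floorRev b D (K + 1) f) := by
  have h_floor : Measurable fun v => ∑ k ∈ Finset.range (K + 1),
      pay b v Finset.univ (floorPrice (K + 1) f M.menu.unitPrice k) :=
    Finset.measurable_sum _ fun k _ => measurable_pay b _ _
  have h_level : Measurable fun v => ∑ A, a A * ∑ k ∈ Finset.range (K + 1), pay b v A (r k) :=
    Finset.measurable_sum _ fun A _ =>
      (Finset.measurable_sum _ fun k _ => measurable_pay b A (r k)).const_mul _
  calc M.revenue
      ≤ ∫⁻ v, (2 * (K + 1 : ℕ) * (∑ A, a A * ∑ k ∈ Finset.range (K + 1), pay b v A (r k)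
            + ∑ j, r 0 j * itemProb (M.choice v) j)
          + 2 * ∑ k ∈ Finset.range (K + 1),
              pay b v Finset.univ (floorPrice (K + 1) f M.menu.unitPrice k)) ∂D := by
        refine lintegral_mono_ae ?_
        filter_upwards [M.isPurchase_choice, hD] with v h_purchase hv
        exact h_purchase.price_le_sum_pay_add_cost_add_sum_pay b ha hu hK hr hτ hτ_top hf
          M.menu_mem hv
    _ = 2 * (K + 1 : ℕ) * ((K + 1 : ℕ) * lawRev b D (K + 1) r a + ∑ j, r 0 j * M.alloc j)
          + 2 * ((K + 1 : ℕ)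
            * setRev b D (K + 1) (floorPrice (K + 1) f M.menu.unitPrice) Finset.univ) := by
        rw [lintegral_add_right _ (h_floor.const_mul _), lintegral_const_mul _ h_floor,
          lintegral_const_mul' _ _ (by finiteness), lintegral_add_left h_level,
          lintegral_sum_mul_sum_pay, M.lintegral_sum_mul_itemProb, lintegral_sum_pay]
    _ ≤ _ := by
        gcongr
        exact le_iSup (fun q => setRev b D (K + 1) (floorPrice (K + 1) f q) Finset.univ) _

theorem revEx_buyManyMenus_le (hD : ∀ᵐ v ∂D, IsSubadditive v) (x : Fin m → ℝ≥0) :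
    revEx D (buyManyMenus m) x ≤
      2 * (K + 1 : ℕ) * ((K + 1 : ℕ) * lawRev b D (K + 1) r a + ∑ j, r 0 j * x j)
      + 2 * ((K + 1 : ℕ) * floorRev b D (K + 1) f) := by
  refine iSup₂_le fun μ hμ => ?_
  calc ∫⁻ M, M.revenue ∂(μ : Measure (Mechanism D (buyManyMenus m)))
      ≤ ∫⁻ M, (2 * (K + 1 : ℕ) * ((K + 1 : ℕ) * lawRev b D (K + 1) r a
            + ∑ j, r 0 j * M.alloc j) + 2 * ((K + 1 : ℕ) * floorRev b D (K + 1) f))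
          ∂(μ : Measure (Mechanism D (buyManyMenus m))) :=
        lintegral_mono fun M => M.revenue_le b ha hu hK hr hτ hτ_top hf hD
    _ = 2 * (K + 1 : ℕ) * ((K + 1 : ℕ) * lawRev b D (K + 1) r a
            + ∑ j, r 0 j * ∫⁻ M, M.alloc j ∂(μ : Measure (Mechanism D (buyManyMenus m))))
          + 2 * ((K + 1 : ℕ) * floorRev b D (K + 1) f) := by
        rw [lintegral_add_right _ measurable_const, lintegral_const_mul' _ _ (by finiteness),
          lintegral_add_left measurable_const,
          lintegral_finsetSum _ fun j _ => (Mechanism.measurable_alloc j).const_mul _]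
        simp only [lintegral_const, measure_univ, mul_one,
          lintegral_const_mul _ (Mechanism.measurable_alloc _)]
    _ ≤ _ := by
        gcongr with j
        exact hμ j

end SingleBuyer

section ManyBuyers

variable {n m : ℕ} (D : Fin n → Measure (Valuation m)) (rule : Fin n → PurchaseRule m) (ρ : ℝ≥0∞)

section

variable (N : ℕ)

lemma costPrice_zero (i : Fin n) (j : Fin m) :
    costPrice D rule N ρ i 0 j = cost D rule N ρ i j + ρ := by
  rw [costPrice_eq, levelPrice, levelCost, pow_zero, mul_one]

lemma mul_two_pow_le_costPrice (i : Fin n) (k : ℕ) (j : Fin m) :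
    ρ * 2 ^ k ≤ costPrice D rule N ρ i k j := by
  rw [costPrice_eq]
  exact le_add_self

lemma monotone_cost (j : Fin m) : Monotone fun i => cost D rule N ρ i j :=
  monotone_nat_of_le_succ fun i => by
    rcases lt_or_ge i n with h | h
    · rw [cost_succ D rule N ρ h, levelCost_eq_add_sum]
      exact le_self_add
    · rw [cost_succ_of_le D rule N ρ h]

variable [NeZero N] [∀ i, IsProbabilityMeasure (D i)]

lemma sum_cost_add_le (i : ℕ) :
    ∑ j, (cost D rule N ρ i j + ρ) ≤ 2 * (m * ρ) + N * seqRev D rule :=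
  calc ∑ j, (cost D rule N ρ i j + ρ) = ∑ j, cost D rule N ρ i j + m * ρ := by
        rw [Finset.sum_add_distrib, Finset.sum_const, Finset.card_univ, Fintype.card_fin,
          nsmul_eq_mul]
    _ ≤ m * ρ + N * seqRev D rule + m * ρ := by
        gcongr
        exact sum_cost_le_seqRev D rule N ρ i
    _ = 2 * (m * ρ) + N * seqRev D rule := by ring

lemma sum_costPrice_mul_le {x : Fin n → Fin m → ℝ≥0} (hx : ∀ j, ∑ i, x i j ≤ 1) :
    ∑ i, ∑ j, costPrice D rule N ρ i 0 j * x i j ≤ 2 * (m * ρ) + N * seqRev D rule :=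
  calc ∑ i, ∑ j, costPrice D rule N ρ i 0 j * x i j
      ≤ ∑ i, ∑ j, (cost D rule N ρ n j + ρ) * x i j := by
        gcongr with i _ j
        rw [costPrice_zero]
        gcongr
        exact monotone_cost D rule ρ N j i.2.le
    _ = ∑ j, (cost D rule N ρ n j + ρ) * ∑ i, (x i j : ℝ≥0∞) := by
        rw [Finset.sum_comm]
        simp only [Finset.mul_sum]
    _ ≤ ∑ j, (cost D rule N ρ n j + ρ) := by
        refine Finset.sum_le_sum fun j _ => mul_le_of_le_one_right' ?_
        exact_mod_cast hx j
    _ ≤ 2 * (m * ρ) + N * seqRev D rule := sum_cost_add_le D rule ρ N n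

lemma sum_lawRev_costLaw_le :
    ∑ i : Fin n, lawRev (rule i) (D i) N (costPrice D rule N ρ i) (costLaw D rule N ρ i) ≤
      seqRev D rule := by
  refine le_trans (le_of_eq ?_) (sum_buyerRev_le_seqRev D rule N (costPrice D rule N ρ) n)
  rw [Finset.sum_range]
  exact Finset.sum_congr rfl fun i _ => by rw [buyerRev, dif_pos i.isLt]

end

variable {D ρ} [∀ i, IsProbabilityMeasure (D i)] (hD : ∀ i, ∀ᵐ v ∂(D i), IsSubadditive v)
include hD

theorem eaRev_buyManyMenus_le {K : ℕ} {f : ℝ≥0∞} (hK : 4 * m ≤ 2 ^ (K + 1)) (hρ_top : ρ ≠ ∞)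
    (hf : 2 * seqRev D rule < f)
    (hρ : m * ρ + (K + 1 : ℕ) * seqRev D rule < ρ * 2 ^ (((K + 1 : ℕ) : ℝ) / 2))
    (hfρ : 4 * (f * m) + 2 * (K + 1 : ℕ) * (2 * (m * ρ) + (K + 1 : ℕ) * seqRev D rule)
      ≤ ρ * 2 ^ K) :
    eaRev D (buyManyMenus m) ≤
      2 * (K + 1 : ℕ) * (2 * (m * ρ) + 2 * ((K + 1 : ℕ) * seqRev D rule))
      + 4 * ((K + 1 : ℕ) * seqRev D rule) := by
  set N := K + 1
  set R := seqRev D rule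
  refine iSup₂_le fun x hx => ?_
  have h_buyer : ∀ i, revEx (D i) (buyManyMenus m) (x i) ≤
      2 * N * (N * lawRev (rule i) (D i) N (costPrice D rule N ρ i) (costLaw D rule N ρ i)
        + ∑ j, costPrice D rule N ρ i 0 j * x i j)
      + 2 * (N * floorRev (rule i) (D i) N f) := fun i => by
    have ha : ∑ A, costLaw D rule N ρ i A = 1 := sum_availLaw D rule _ i
    have h_double : ∀ k j, costPrice D rule N ρ i (k + 1) j ≤ 2 * costPrice D rule N ρ i k j := by
      rw [costPrice_eq]
      exact levelPrice_succ_le _ _ _ _ ha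
    refine revEx_buyManyMenus_le (rule i) ha (fun j => unavail_costLaw_le_half D rule N ρ i j hρ)
      hK h_double (τ := ρ * 2 ^ K) (mul_two_pow_le_costPrice D rule ρ N i K) (by finiteness)
      (le_trans ?_ hfρ) (hD i) (x i)
    simp only [costPrice_zero]
    gcongr
    exact sum_cost_add_le D rule ρ N i
  calc ∑ i, revEx (D i) (buyManyMenus m) (x i)
      ≤ 2 * N * (N * ∑ i : Fin n,
          lawRev (rule i) (D i) N (costPrice D rule N ρ i) (costLaw D rule N ρ i)
          + ∑ i, ∑ j, costPrice D rule N ρ i 0 j * x i j)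
        + 2 * (N * ∑ i, floorRev (rule i) (D i) N f) := by
        simp only [Finset.mul_sum, ← Finset.sum_add_distrib]
        simpa only [Finset.mul_sum] using Finset.sum_le_sum fun i _ => h_buyer i
    _ ≤ 2 * N * (N * R + (2 * (m * ρ) + N * R)) + 2 * (N * (2 * R)) := by
        gcongr
        · exact sum_lawRev_costLaw_le D rule ρ N
        · exact sum_costPrice_mul_le D rule ρ N hx
        · exact sum_floorRev_le D rule N hf
    _ = _ := by ring

end ManyBuyers

section Constants

variable {m : ℕ}

lemma clog_le_three_mul_log (hm : 2 ≤ m) : (Nat.clog 2 m : ℝ) ≤ 3 * Real.log m := by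
  have h_pos : 1 ≤ Nat.clog 2 m := Nat.clog_pos one_lt_two hm
  have h_pow : (2 : ℝ) ^ (Nat.clog 2 m - 1) ≤ m := by
    exact_mod_cast (Nat.pow_pred_clog_lt_self one_lt_two (by omega)).le
  have h_log : ((Nat.clog 2 m : ℝ) - 1) * Real.log 2 ≤ Real.log m := by
    have h_log_pow := Real.log_le_log (by positivity) h_pow
    rwa [Real.log_pow, Nat.cast_sub h_pos, Nat.cast_one] at h_log_pow
  have h_log_two : Real.log 2 ≤ Real.log m :=
    Real.log_le_log two_pos (by exact_mod_cast hm)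
  have h_two_thirds : (Nat.clog 2 m : ℝ) * (2 / 3) ≤ Nat.clog 2 m * Real.log 2 := by
    gcongr
    linarith [Real.log_two_gt_d9]
  linarith

lemma clog_sq_le_ofReal_log_sq (hm : 2 ≤ m) :
    (Nat.clog 2 m : ℝ≥0∞) ^ 2 ≤ 9 * ENNReal.ofReal (Real.log m ^ 2) := by
  have h_sq : (Nat.clog 2 m : ℝ) ^ 2 ≤ 9 * Real.log m ^ 2 :=
    calc (Nat.clog 2 m : ℝ) ^ 2 ≤ (3 * Real.log m) ^ 2 := by
          gcongr
          exact clog_le_three_mul_log hm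
      _ = 9 * Real.log m ^ 2 := by ring
  calc (Nat.clog 2 m : ℝ≥0∞) ^ 2 = ENNReal.ofReal ((Nat.clog 2 m : ℝ) ^ 2) := by
        rw [ENNReal.ofReal_pow (Nat.cast_nonneg _), ENNReal.ofReal_natCast]
    _ ≤ ENNReal.ofReal (9 * Real.log m ^ 2) := ENNReal.ofReal_le_ofReal h_sq
    _ = 9 * ENNReal.ofReal (Real.log m ^ 2) := by
        rw [ENNReal.ofReal_mul (by norm_num), ENNReal.ofReal_ofNat]

variable {d : ℕ} (hd : 1 ≤ d)
include hd

lemma level_bound_le_mul_sq {B R : ℝ≥0∞} (hR : R ≤ B) :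
    2 * (12 * d + 1 : ℕ) * (2 * B + 2 * ((12 * d + 1 : ℕ) * R)) + 4 * ((12 * d + 1 : ℕ) * R)
      ≤ 780 * (d : ℝ≥0∞) ^ 2 * B :=
  calc 2 * (12 * d + 1 : ℕ) * (2 * B + 2 * ((12 * d + 1 : ℕ) * R)) + 4 * ((12 * d + 1 : ℕ) * R)
      ≤ 2 * (12 * d + 1 : ℕ) * (2 * B + 2 * ((12 * d + 1 : ℕ) * B))
        + 4 * ((12 * d + 1 : ℕ) * B) := by gcongr
    _ = (4 * (12 * d + 1) ^ 2 + 8 * (12 * d + 1) : ℕ) * B := by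
        push_cast
        ring
    _ ≤ (780 * d ^ 2 : ℕ) * B := by
        gcongr
        nlinarith
    _ = 780 * (d : ℝ≥0∞) ^ 2 * B := by push_cast; rfl

variable (hmd : m ≤ 2 ^ d)
include hmd

lemma level_mul_lt_two_pow : (12 * d + 2) * m < 2 ^ (6 * d) := by
  have h_two : 2 ≤ 2 ^ d := by simpa using Nat.pow_le_pow_right two_pos hd
  have h_lt : d < 2 ^ d := Nat.lt_two_pow_self
  rw [mul_comm 6, pow_mul]
  set x := 2 ^ d
  calc (12 * d + 2) * m ≤ 14 * x * x := by gcongr; omega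
    _ = 14 * x ^ 2 := by ring
    _ < 2 ^ 4 * x ^ 2 := by gcongr; norm_num
    _ ≤ x ^ 4 * x ^ 2 := by gcongr
    _ = x ^ 6 := by ring

lemma level_sq_mul_le_two_pow :
    8 * m * m + 2 * (12 * d + 1) * (12 * d + 3) * m ≤ 2 ^ (12 * d) := by
  have h_two : 2 ≤ 2 ^ d := by simpa using Nat.pow_le_pow_right two_pos hd
  have h_lt : d < 2 ^ d := Nat.lt_two_pow_self
  rw [mul_comm 12, pow_mul]
  set x := 2 ^ d
  calc 8 * m * m + 2 * (d * 12 + 1) * (d * 12 + 3) * m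
      ≤ 4 * 2 * x * x + 2 * (13 * x) * (15 * x) * x := by gcongr <;> omega
    _ ≤ 4 * x * x * x + 2 * (13 * x) * (15 * x) * x := by gcongr
    _ = 394 * x ^ 3 := by ring
    _ ≤ 2 ^ 9 * x ^ 3 := by gcongr; norm_num
    _ ≤ x ^ 9 * x ^ 3 := by gcongr
    _ = x ^ 12 := by ring

lemma mul_add_level_mul_lt {ρ R : ℝ≥0∞} (hρ_zero : ρ ≠ 0) (hρ_top : ρ ≠ ∞) (hR : R ≤ m * ρ) :
    m * ρ + (12 * d + 1 : ℕ) * R < ρ * 2 ^ (((12 * d + 1 : ℕ) : ℝ) / 2) :=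
  calc m * ρ + (12 * d + 1 : ℕ) * R ≤ m * ρ + (12 * d + 1 : ℕ) * (m * ρ) := by gcongr
    _ = ρ * ((12 * d + 2) * m : ℕ) := by
        push_cast
        ring
    _ < ρ * (2 ^ (6 * d) : ℕ) := by
        refine ENNReal.mul_lt_mul_right hρ_zero hρ_top ?_
        exact_mod_cast level_mul_lt_two_pow hd hmd
    _ ≤ ρ * 2 ^ (((12 * d + 1 : ℕ) : ℝ) / 2) := by
        rw [Nat.cast_pow, Nat.cast_ofNat, ← ENNReal.rpow_natCast]
        gcongr
        · norm_num
        · push_cast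
          linarith

lemma floor_add_level_mul_le {ρ R : ℝ≥0∞} (hR : R ≤ m * ρ) :
    4 * (2 * (m * ρ) * m) + 2 * (12 * d + 1 : ℕ) * (2 * (m * ρ) + (12 * d + 1 : ℕ) * R)
      ≤ ρ * 2 ^ (12 * d) :=
  calc 4 * (2 * (m * ρ) * m) + 2 * (12 * d + 1 : ℕ) * (2 * (m * ρ) + (12 * d + 1 : ℕ) * R)
      ≤ 4 * (2 * (m * ρ) * m)
        + 2 * (12 * d + 1 : ℕ) * (2 * (m * ρ) + (12 * d + 1 : ℕ) * (m * ρ)) := by gcongr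
    _ = ρ * (8 * m * m + 2 * (12 * d + 1) * (12 * d + 3) * m : ℕ) := by
        push_cast
        ring
    _ ≤ ρ * 2 ^ (12 * d) := by
        gcongr
        exact_mod_cast level_sq_mul_le_two_pow hd hmd

end Constants

section CompetitiveRatio

variable {n m : ℕ} {D : Fin n → Measure (Valuation m)} [∀ i, IsProbabilityMeasure (D i)]
  (rule : Fin n → PurchaseRule m)

/- The parameters are `N = 12 d + 1` levels, where `d = ⌈log₂ m⌉`, and the floor `2 * (m * ρ)`. -/
lemma eaRev_le_of_seqRev_lt (hD : ∀ i, ∀ᵐ v ∂(D i), IsSubadditive v) (hm : 2 ≤ m) {ρ : ℝ≥0∞}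
    (hρ_top : ρ ≠ ∞) (hR : seqRev D rule < m * ρ) :
    eaRev D (buyManyMenus m) ≤ 780 * (Nat.clog 2 m : ℝ≥0∞) ^ 2 * (m * ρ) := by
  have hmd : m ≤ 2 ^ Nat.clog 2 m := Nat.le_pow_clog one_lt_two m
  have hd : 1 ≤ Nat.clog 2 m := Nat.clog_pos one_lt_two hm
  set d := Nat.clog 2 m
  set R := seqRev D rule
  have hρ_zero : ρ ≠ 0 := by
    rintro rfl
    simp at hR
  have h_supply : 4 * m ≤ 2 ^ (12 * d + 1) :=
    calc 4 * m ≤ 2 ^ 2 * 2 ^ d := by gcongr; norm_num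
      _ = 2 ^ (2 + d) := (pow_add _ _ _).symm
      _ ≤ 2 ^ (12 * d + 1) := Nat.pow_le_pow_right two_pos (by omega)
  have h_floor : 2 * R < 2 * (m * ρ) :=
    ENNReal.mul_lt_mul_right two_ne_zero ENNReal.ofNat_ne_top hR
  exact (eaRev_buyManyMenus_le rule hD h_supply hρ_top h_floor
    (mul_add_level_mul_lt hd hmd hρ_zero hρ_top hR.le)
    (floor_add_level_mul_le hd hmd hR.le)).trans (level_bound_le_mul_sq hd hR.le)

theorem eaRev_le_clog_sq_mul_seqRev (hD : ∀ i, ∀ᵐ v ∂(D i), IsSubadditive v) (hm : 2 ≤ m) :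
    eaRev D (buyManyMenus m) ≤ 780 * (Nat.clog 2 m : ℝ≥0∞) ^ 2 * seqRev D rule := by
  have h_clog : Nat.clog 2 m ≠ 0 := (Nat.clog_pos one_lt_two hm).ne'
  have h_zero : 780 * (Nat.clog 2 m : ℝ≥0∞) ^ 2 ≠ 0 := by simpa using h_clog
  have h_top : 780 * (Nat.clog 2 m : ℝ≥0∞) ^ 2 ≠ ∞ := by finiteness
  rw [mul_comm, ← ENNReal.div_le_iff h_zero h_top]
  refine le_of_forall_gt_imp_ge_of_dense fun B hB => ?_
  rcases eq_or_ne B ∞ with rfl | hB_top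
  · exact le_top
  have hm_zero : (m : ℝ≥0∞) ≠ 0 := by exact_mod_cast (two_pos.trans_le hm).ne'
  have h_mul : (m : ℝ≥0∞) * (B / m) = B :=
    ENNReal.mul_div_cancel hm_zero (ENNReal.natCast_ne_top m)
  rw [ENNReal.div_le_iff h_zero h_top, mul_comm, ← h_mul]
  exact eaRev_le_of_seqRev_lt rule hD hm (ENNReal.div_ne_top hB_top hm_zero) (h_mul.symm ▸ hB)

end CompetitiveRatio

end BuyMany

end

theorem mainTheorem2 :
    ∃ C : ℝ≥0, ∀ (n m : ℕ), 2 ≤ m →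
      ∀ D : Fin n → Measure (BuyMany.Valuation m),
        (∀ i, IsProbabilityMeasure (D i)) →
        (∀ i, ∀ᵐ v ∂(D i), BuyMany.IsSubadditive v) →
        ∀ rule : Fin n → BuyMany.PurchaseRule m,
          BuyMany.eaRev D (BuyMany.buyManyMenus m) ≤
            C * ENNReal.ofReal (Real.log m ^ 2) * BuyMany.seqRev D rule := by
  refine ⟨7020, fun n m hm D _ hD rule => ?_⟩
  calc BuyMany.eaRev D (BuyMany.buyManyMenus m)
      ≤ 780 * (Nat.clog 2 m : ℝ≥0∞) ^ 2 * BuyMany.seqRev D rule :=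
        BuyMany.eaRev_le_clog_sq_mul_seqRev rule hD hm
    _ ≤ 780 * (9 * ENNReal.ofReal (Real.log m ^ 2)) * BuyMany.seqRev D rule := by
        gcongr
        exact BuyMany.clog_sq_le_ofReal_log_sq hm
    _ = (7020 : ℝ≥0) * ENNReal.ofReal (Real.log m ^ 2) * BuyMany.seqRev D rule := by
        push_cast
        ring
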